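/- Let $k$ be a commutative ring and let $\mathcal D$ be a nonempty class of finite groups that contains every group isomorphic to a subquotient of one of its members or to a direct product of two of its members, regarded as a full subcategory of the biset category: $\mathrm{Hom}(H,K)=B(K,H)$, the Grothendieck group of finite $(K,H)$-bisets, with composition induced by $Y\times_K X$. A biset functor is a $k$-linear functor from the $k$-linearization $k\mathcal D$ to $k$-modules. A Green biset functor $A$ is a biset functor with bilinear products $A(K)\times A(H)\to A(K\times H)$, $(a,b)\mapsto a\times b$, and an element $\varepsilon_A\in A(1)$, which are associative, unital and functorial in the usual sense. Its associated category $\mathcal P_A$ has the same objects as $\mathcal D$, morphisms $\mathcal P_A(H,K)=A(K\times H)$, composition $\beta\circ\alpha=A(L\times\overleftarrow K\times H)(\beta\times\alpha)$ for $\beta\in A(L\times K)$, $\alpha\in A(K\times H)$, and identities $A(\overrightarrow H)(\varepsilon_A)$, where $\overrightarrow H$ is the $(H\times H,1)$-biset $H$ with $(h_1,h_2)\cdot h=h_1hh_2^{-1}$ and $\overleftarrow H$ is its opposite. An $A$-module is a $k$-linear functor from $\mathcal P_A$ to $k$-modules; $A$ is an $A$-module by $\alpha\cdot a=A(K\times\overleftarrow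 H)(\alpha\times a)$ for $\alpha\in A(K\times H)$, $a\in A(H)$. A two-sided ideal of $A$ is a biset subfunctor $I$ with $a\times x$ and $x\times a$ in $I$ for all $x$ in $I$ and $a$ in $A$; it is an $A$-module by restriction. The essential algebra is $\widehat A(H)=\mathrm{End}_{\mathcal P_A}(H)/I_A(H)$, where $I_A(H)$ is the $k$-submodule generated by the endomorphisms of $H$ that factor through groups of order smaller than $|H|$. For $G$ in $\mathcal D$, let $A_G$ be the Green biset functor with $A_G(H)=A(H\times G)$, $A_G(\alpha)=A(\alpha\times \mathrm{Id}_G)$, product $a\times^d b$ equal to the restriction of $a\times b$ along $K\times H\times G\to K\times G\times H\times G$, $(k,h,g)\mapsto(k,g,h,g)$, for $a\in A(K\times G)$ and $b\in A(H\times G)$, and $\varepsilon_{A_G}=A(\mathrm{Inf}_1^{1\times G})(\varepsilon_A)$. Let $\mathrm{Inf}:A\to A_G$ and $\mathrm{Res}:A_G\to A$ be the morphisms of Green biset functors given by $A(\mathrm{Inf}_H^{H\times G})$ and $A(\mathrm{Res}_H^{H\times G})$, let $\mathrm{Inf}^*$ be the induced pullback from $A_G$-modules to $A$-modules, and let $\kappa_G=\ker(\mathrm{Res})$.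 **Proposition.** $\kappa_G$ is a two-sided ideal of $A_G$, and there is an isomorphism of $A$-modules $$\mathrm{Inf}^*A_G\cong A\oplus\kappa_G,$$ where $\kappa_G$ is an $A$-module through $\mathrm{Inf}$. Furthermore, for every $H$ in $\mathcal D$ there is an isomorphism $$\mathrm{End}_{\mathcal P_{A_G}}(H)\cong \mathrm{End}_{\mathcal P_A}(H)\oplus\kappa_G(H\times H)$$ of left $\mathrm{End}_{\mathcal P_A}(H)$-modules (through the ring homomorphism $\mathrm{End}_{\mathcal P_A}(H)\to \mathrm{End}_{\mathcal P_{A_G}}(H)$ induced by $\mathrm{Inf}$), which passes to the quotients to give an isomorphism $$\widehat{A_G}(H)\cong\widehat A(H)\oplus\widehat{\kappa_G}(H)$$ of left $\widehat A(H)$-modules (through the induced ring homomorphism $\widehat A(H)\to\widehat{A_G}(H)$), where $\widehat{\kappa_G}(H)$ is the image of $\kappa_G(H\times H)$ in $\widehat{A_G}(H)$. -/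

import Mathlib

universe u v w

namespace GreenBiset

open CategoryTheory TensorProduct

/-! ## Bisets -/

/-- A finite `(K, H)`-biset: a finite set with a left action of `K` and a right action of `H`
which commute. -/
structure Biset (K H : Type u) [Group K] [Group H] where
  carrier : Type u
  finite : Finite carrier
  lact : K → carrier → carrier
  ract : carrier → H → carrier
  one_lact : ∀ x, lact 1 x = x
  mul_lact : ∀ k k' x, lact (k * k') x = lact k (lact k' x)
  ract_one : ∀ x, ract x 1 = x
  ract_mul : ∀ x h h', ract x (h * h') = ract (ract x h) h'
  lact_ract : ∀ k x h, ract (lact k x) h = lact k (ract x h)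

namespace Biset

attribute [simp] one_lact ract_one

section
variable {K H L M T : Type u} [Group K] [Group H] [Group L] [Group M] [Group T]

/-- Two bisets are isomorphic if there is a bijection between them that respects both actions. -/
def IsIso (X Y : Biset K H) : Prop :=
  ∃ e : X.carrier ≃ Y.carrier,
    (∀ k x, e (X.lact k x) = Y.lact k (e x)) ∧ (∀ x h, e (X.ract x h) = Y.ract (e x) h)

theorem IsIso.refl (X : Biset K H) : IsIso X X := ⟨Equiv.refl _, by simp, by simp⟩

theorem IsIso.symm {X Y : Biset K H} : IsIso X Y → IsIso Y X := by
  rintro ⟨e, h1, h2⟩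
  refine ⟨e.symm, fun k x => ?_, fun x h => ?_⟩
  · rw [Equiv.symm_apply_eq, h1, Equiv.apply_symm_apply]
  · rw [Equiv.symm_apply_eq, h2, Equiv.apply_symm_apply]

theorem IsIso.trans {X Y Z : Biset K H} : IsIso X Y → IsIso Y Z → IsIso X Z := by
  rintro ⟨e, h1, h2⟩ ⟨f, h3, h4⟩
  exact ⟨e.trans f, by simp [h1, h3], by simp [h2, h4]⟩

variable (K H) in
instance setoid : Setoid (Biset K H) := ⟨IsIso, IsIso.refl, IsIso.symm, IsIso.trans⟩

variable (K H) in
/-- The empty biset. -/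
def empty : Biset K H where
  carrier := PEmpty
  finite := inferInstance
  lact _ x := x
  ract x _ := x
  one_lact _ := rfl
  mul_lact _ _ _ := rfl
  ract_one _ := rfl
  ract_mul _ _ _ := rfl
  lact_ract _ _ _ := rfl

/-- The disjoint union of two bisets. -/
abbrev sum (X Y : Biset K H) : Biset K H where
  carrier := X.carrier ⊕ Y.carrier
  finite := by
    have := X.finite
    have := Y.finite
    infer_instance
  lact k := Sum.map (X.lact k) (Y.lact k)
  ract x h := Sum.map (fun x => X.ract x h) (fun y => Y.ract y h) x
  one_lact := by rintro (x | x) <;> simp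
  mul_lact := by rintro k k' (x | x) <;> simp [mul_lact]
  ract_one := by rintro (x | x) <;> simp
  ract_mul := by rintro (x | x) h h' <;> simp [ract_mul]
  lact_ract := by rintro k (x | x) h <;> simp [lact_ract]

theorem sum_congr {X X' Y Y' : Biset K H} : IsIso X X' → IsIso Y Y' →
    IsIso (sum X Y) (sum X' Y') := by
  rintro ⟨e, h1, h2⟩ ⟨f, h3, h4⟩
  refine ⟨Equiv.sumCongr e f, ?_, ?_⟩
  · rintro k (x | x)
    · exact congrArg Sum.inl (h1 k x)
    · exact congrArg Sum.inr (h3 k x)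
  · rintro (x | x) h
    · exact congrArg Sum.inl (h2 x h)
    · exact congrArg Sum.inr (h4 x h)

theorem sum_comm (X Y : Biset K H) : IsIso (sum X Y) (sum Y X) := by
  refine ⟨Equiv.sumComm _ _, ?_, ?_⟩
  · rintro k (x | x) <;> rfl
  · rintro (x | x) h <;> rfl

theorem sum_assoc (X Y Z : Biset K H) : IsIso (sum (sum X Y) Z) (sum X (sum Y Z)) := by
  refine ⟨Equiv.sumAssoc _ _ _, ?_, ?_⟩
  · rintro k ((x | x) | x) <;> rfl
  · rintro ((x | x) | x) h <;> rfl

theorem empty_sum (X : Biset K H) : IsIso (sum (empty K H) X) X := by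
  refine ⟨Equiv.emptySum PEmpty _, ?_, ?_⟩
  · rintro k (x | x)
    · exact x.elim
    · rfl
  · rintro (x | x) h
    · exact x.elim
    · rfl

/-! ### Composition -/

/-- Two elements of `Y × X` are related if they are in the same orbit of the middle group, which
acts by `k · (y, x) = (y · k⁻¹, k · x)`. -/
def compSetoid (Y : Biset L K) (X : Biset K H) : Setoid (Y.carrier × X.carrier) where
  r p q := ∃ k : K, q = (Y.ract p.1 k⁻¹, X.lact k p.2)
  iseqv := by
    refine ⟨fun p => ⟨1, by simp⟩, ?_, ?_⟩
    · rintro p _ ⟨k, rfl⟩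
      exact ⟨k⁻¹, by simp [← ract_mul, ← mul_lact]⟩
    · rintro p _ _ ⟨k, rfl⟩ ⟨k', rfl⟩
      exact ⟨k' * k, by simp [← ract_mul, ← mul_lact]⟩

/-- The composition `Y ×_K X` of bisets: the set of `K`-orbits on `Y × X`. -/
def comp (Y : Biset L K) (X : Biset K H) : Biset L H where
  carrier := Quotient (compSetoid Y X)
  finite := by
    have := X.finite
    have := Y.finite
    infer_instance
  lact l := Quotient.map' (s₁ := compSetoid Y X) (s₂ := compSetoid Y X)
    (fun p => (Y.lact l p.1, p.2)) (by
      rintro p _ ⟨k, rfl⟩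
      exact ⟨k, by simp [lact_ract]⟩)
  ract q h := Quotient.map' (s₁ := compSetoid Y X) (s₂ := compSetoid Y X)
    (fun p => (p.1, X.ract p.2 h)) (by
      rintro p _ ⟨k, rfl⟩
      exact ⟨k, by simp [lact_ract]⟩) q
  one_lact := by rintro ⟨p⟩; exact congrArg (Quotient.mk (compSetoid Y X)) (by simp)
  mul_lact := by rintro l l' ⟨p⟩; exact congrArg (Quotient.mk (compSetoid Y X)) (by simp [mul_lact])
  ract_one := by rintro ⟨p⟩; exact congrArg (Quotient.mk (compSetoid Y X)) (by simp)
  ract_mul := by rintro ⟨p⟩ h h'; exact congrArg (Quotient.mk (compSetoid Y X)) (by simp [ract_mul])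
  lact_ract := by rintro l ⟨p⟩ h; rfl

/-- The class `[y, x]` in `Y ×_K X`. -/
def comp.mk {Y : Biset L K} {X : Biset K H} (y : Y.carrier) (x : X.carrier) :
    (comp Y X).carrier := Quotient.mk (compSetoid Y X) (y, x)

theorem comp.ind {Y : Biset L K} {X : Biset K H} {P : (comp Y X).carrier → Prop}
    (h : ∀ y x, P (comp.mk y x)) (q) : P q := by
  rcases q with ⟨y, x⟩
  exact h y x

@[simp] theorem comp.lact_mk {Y : Biset L K} {X : Biset K H} (l : L) (y : Y.carrier)
    (x : X.carrier) : (comp Y X).lact l (comp.mk y x) = comp.mk (Y.lact l y) x := rfl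

@[simp] theorem comp.ract_mk {Y : Biset L K} {X : Biset K H} (h : H) (y : Y.carrier)
    (x : X.carrier) : (comp Y X).ract (comp.mk y x) h = comp.mk y (X.ract x h) := rfl

theorem comp.mk_ract {Y : Biset L K} {X : Biset K H} (y : Y.carrier) (k : K) (x : X.carrier) :
    (comp.mk (Y.ract y k) x : (comp Y X).carrier) = comp.mk y (X.lact k x) :=
  Quotient.sound (s := compSetoid Y X) ⟨k, by simp [← ract_mul]⟩

/-- A balanced map out of a composition. -/
def comp.lift {Y : Biset L K} {X : Biset K H} {α : Sort*} (f : Y.carrier → X.carrier → α)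
    (hf : ∀ y k x, f (Y.ract y k) x = f y (X.lact k x)) : (comp Y X).carrier → α :=
  Quotient.lift (s := compSetoid Y X) (fun p => f p.1 p.2) (by
    rintro p _ ⟨k, rfl⟩
    simp [hf, ← mul_lact])

@[simp] theorem comp.lift_mk {Y : Biset L K} {X : Biset K H} {α : Sort*}
    (f : Y.carrier → X.carrier → α) (hf) (y x) : comp.lift f hf (comp.mk y x) = f y x := rfl

/-- A criterion to recognize a composition. -/
theorem comp_isIso {Y : Biset L K} {X : Biset K H} {Z : Biset L H}
    (f : Y.carrier → X.carrier → Z.carrier) (g : Z.carrier → (comp Y X).carrier)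
    (hf : ∀ y k x, f (Y.ract y k) x = f y (X.lact k x))
    (hl : ∀ l y x, f (Y.lact l y) x = Z.lact l (f y x))
    (hr : ∀ y x h, f y (X.ract x h) = Z.ract (f y x) h)
    (hgf : ∀ y x, g (f y x) = comp.mk y x)
    (hfg : ∀ z, comp.lift f hf (g z) = z) : IsIso (comp Y X) Z := by
  refine ⟨⟨comp.lift f hf, g, fun q => ?_, hfg⟩, fun l q => ?_, fun q h => ?_⟩
  · induction q using comp.ind with | h y x => exact hgf y x
  · induction q using comp.ind with | h y x => exact hl l y x
  · induction q using comp.ind with | h y x => exact hr y x h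

theorem comp_congr {Y Y' : Biset L K} {X X' : Biset K H} : IsIso Y Y' → IsIso X X' →
    IsIso (comp Y X) (comp Y' X') := by
  rintro ⟨e, h1, h2⟩ ⟨f, h3, h4⟩
  have h5 : ∀ y k, e.symm (Y'.ract y k) = Y.ract (e.symm y) k := fun y k => by
    rw [Equiv.symm_apply_eq, h2, Equiv.apply_symm_apply]
  have h6 : ∀ k x, f.symm (X'.lact k x) = X.lact k (f.symm x) := fun y k => by
    rw [Equiv.symm_apply_eq, h3, Equiv.apply_symm_apply]
  refine comp_isIso (fun y x => comp.mk (e y) (f x))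
    (comp.lift (fun y x => comp.mk (e.symm y) (f.symm x)) ?_) ?_ ?_ ?_ ?_ ?_
  · intro y k x; simp [h5, h6, comp.mk_ract]
  · intro y k x; simp [h2, h3, comp.mk_ract]
  · intro y k x; simp [h1]
  · intro y k x; simp [h4]
  · intro y x; simp
  · intro z
    induction z using comp.ind with | h y x => simp

theorem sum_comp (Y Y' : Biset L K) (X : Biset K H) :
    IsIso (comp (sum Y Y') X) (sum (comp Y X) (comp Y' X)) := by
  refine comp_isIso
    (fun y x => Sum.map (fun y => comp.mk y x) (fun y => comp.mk y x) y)
    (Sum.elim (comp.lift (fun y x => comp.mk (Sum.inl y) x) ?_)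
      (comp.lift (fun y x => comp.mk (Sum.inr y) x) ?_)) ?_ ?_ ?_ ?_ ?_
  · intro y k x; exact comp.mk_ract (Y := sum Y Y') (Sum.inl y) k x
  · intro y k x; exact comp.mk_ract (Y := sum Y Y') (Sum.inr y) k x
  · rintro (y | y) k x <;> simp [sum, comp.mk_ract]
  · rintro l (y | y) x <;> simp [sum]
  · rintro (y | y) x h <;> simp [sum]
  · rintro (y | y) x <;> rfl
  · rintro (z | z) <;> induction z using comp.ind with | h y x => rfl

theorem comp_sum (Y : Biset L K) (X X' : Biset K H) :
    IsIso (comp Y (sum X X')) (sum (comp Y X) (comp Y X')) := by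
  refine comp_isIso
    (fun y x => Sum.map (fun x => comp.mk y x) (fun x => comp.mk y x) x)
    (Sum.elim (comp.lift (fun y x => comp.mk y (Sum.inl x)) ?_)
      (comp.lift (fun y x => comp.mk y (Sum.inr x)) ?_)) ?_ ?_ ?_ ?_ ?_
  · intro y k x; exact comp.mk_ract (X := sum X X') y k (Sum.inl x)
  · intro y k x; exact comp.mk_ract (X := sum X X') y k (Sum.inr x)
  · rintro y k (x | x) <;> simp [sum, comp.mk_ract]
  · rintro l y (x | x) <;> simp [sum]
  · rintro y (x | x) h <;> simp [sum]
  · rintro y (x | x) <;> rfl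
  · rintro (z | z) <;> induction z using comp.ind with | h y x => rfl

theorem comp_assoc (Z : Biset M L) (Y : Biset L K) (X : Biset K H) :
    IsIso (comp (comp Z Y) X) (comp Z (comp Y X)) := by
  have h1 : ∀ x, ∀ (z : Z.carrier) (k : L) (y : Y.carrier),
      (comp.mk (Z.ract z k) (comp.mk y x) : (comp Z (comp Y X)).carrier) =
        comp.mk z (comp.mk (Y.lact k y) x) := by
    intro x z k y; rw [comp.mk_ract]; simp
  have h2 : ∀ z, ∀ (y : Y.carrier) (k : K) (x : X.carrier),
      (comp.mk (comp.mk z (Y.ract y k)) x : (comp (comp Z Y) X).carrier) =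
        comp.mk (comp.mk z y) (X.lact k x) := by
    intro x z k y; rw [← comp.mk_ract]; simp
  refine comp_isIso
    (fun q x => comp.lift (fun z y => comp.mk z (comp.mk y x)) (h1 x) q)
    (comp.lift (fun z q => comp.lift (fun y x => comp.mk (comp.mk z y) x) (h2 z) q) ?_)
    ?_ ?_ ?_ ?_ ?_
  · intro z k q; induction q using comp.ind with | h y x => simp [comp.mk_ract]
  · intro q k x; induction q using comp.ind with | h z y => simp [comp.mk_ract]
  · intro m q x; induction q using comp.ind with | h z y => simp
  · intro q x h; induction q using comp.ind with | h z y => simp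
  · intro q x; induction q using comp.ind with | h z y => simp
  · intro q
    induction q using comp.ind with | h z q => induction q using comp.ind with | h y x => simp

/-! ### Bisets attached to group homomorphisms -/

/-- For a group homomorphism `ψ : H →* L`, the `(H, L)`-biset `L` with `h · g · g₀ = ψ(h) g g₀`. -/
abbrev res [Finite L] (ψ : H →* L) : Biset H L where
  carrier := L
  finite := inferInstance
  lact h g := ψ h * g
  ract g g' := g * g'
  one_lact _ := by simp
  mul_lact _ _ _ := by simp [mul_assoc]
  ract_one _ := by simp
  ract_mul _ _ _ := by simp [mul_assoc]
  lact_ract _ _ _ := by simp [mul_assoc]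

/-- For a group homomorphism `ψ : H →* L`, the `(L, H)`-biset `L` with `g₀ · g · h = g₀ g ψ(h)`. -/
abbrev ind [Finite L] (ψ : H →* L) : Biset L H where
  carrier := L
  finite := inferInstance
  lact g' g := g' * g
  ract g h := g * ψ h
  one_lact _ := by simp
  mul_lact _ _ _ := by simp [mul_assoc]
  ract_one _ := by simp
  ract_mul _ _ _ := by simp [mul_assoc]
  lact_ract _ _ _ := by simp [mul_assoc]

variable (H) in
/-- The identity biset `H`, with actions given by multiplication. -/
abbrev id [Finite H] : Biset H H := res (MonoidHom.id H)

/-- The biset `Iso(ψ)` of a group isomorphism. -/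
abbrev iso [Finite L] (ψ : H ≃* L) : Biset L H := ind ψ.toMonoidHom

theorem iso_isIso [Finite H] [Finite L] (ψ : H ≃* L) : IsIso (iso ψ) (res ψ.symm.toMonoidHom) := by
  refine ⟨ψ.symm.toEquiv, fun l x => ?_, fun x h => ?_⟩
  · exact map_mul ψ.symm l x
  · exact (map_mul ψ.symm x (ψ h)).trans (congrArg (ψ.symm x * ·) (ψ.symm_apply_apply h))

/-- The restriction of the left action along a group homomorphism. -/
abbrev restrict (ψ : H →* L) (X : Biset L M) : Biset H M where
  carrier := X.carrier
  finite := X.finite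
  lact h x := X.lact (ψ h) x
  ract := X.ract
  one_lact _ := by simp
  mul_lact _ _ _ := by simp [mul_lact]
  ract_one := X.ract_one
  ract_mul := X.ract_mul
  lact_ract _ _ _ := X.lact_ract _ _ _

/-- The restriction of the right action along a group homomorphism. -/
abbrev corestrict (X : Biset M L) (ψ : H →* L) : Biset M H where
  carrier := X.carrier
  finite := X.finite
  lact := X.lact
  ract x h := X.ract x (ψ h)
  one_lact := X.one_lact
  mul_lact := X.mul_lact
  ract_one _ := by simp
  ract_mul _ _ _ := by simp [ract_mul]
  lact_ract _ _ _ := X.lact_ract _ _ _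

theorem comp_ind [Finite L] (X : Biset M L) (ψ : H →* L) :
    IsIso (comp X (ind ψ)) (corestrict X ψ) := by
  refine comp_isIso (Y := X) (X := ind ψ) (Z := corestrict X ψ) (fun x l => X.ract x l)
    (fun x => comp.mk x (1 : L)) ?_ ?_ ?_ ?_ ?_
  · intro y k x; exact (X.ract_mul _ _ _).symm
  · intro y k x; exact X.lact_ract _ _ _
  · intro y k x; exact (X.ract_mul _ _ _)
  · intro x l
    refine (comp.mk_ract (X := ind ψ) x l (1 : L)).trans ?_
    exact congrArg (fun t : L => (comp.mk x t : (comp X (ind ψ)).carrier)) (mul_one l)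
  · intro x; exact X.ract_one x

theorem res_comp [Finite L] (ψ : H →* L) (X : Biset L M) : IsIso (comp (res ψ) X) (restrict ψ X) := by
  refine comp_isIso (Y := res ψ) (X := X) (Z := restrict ψ X) (fun l x => X.lact l x)
    (fun x => comp.mk (1 : L) x) ?_ ?_ ?_ ?_ ?_
  · intro y k x; exact X.mul_lact _ _ _
  · intro y k x; exact X.mul_lact _ _ _
  · intro y k x; exact (X.lact_ract _ _ _).symm
  · intro l x
    refine (comp.mk_ract (Y := res ψ) (1 : L) l x).symm.trans ?_
    exact congrArg (fun t : L => (comp.mk t x : (comp (res ψ) X).carrier)) (one_mul l)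
  · intro x; exact X.one_lact x

theorem id_comp [Finite L] (X : Biset L M) : IsIso (comp (id L) X) X := res_comp _ _

theorem comp_id [Finite M] (X : Biset L M) : IsIso (comp X (id M)) X := by
  refine comp_isIso (Y := X) (X := id M) (fun x m => X.ract x m)
    (fun x => comp.mk x (1 : M)) ?_ ?_ ?_ ?_ ?_
  · intro y k x; exact (X.ract_mul _ _ _).symm
  · intro y k x; exact X.lact_ract _ _ _
  · intro y k x; exact (X.ract_mul _ _ _)
  · intro x l
    refine (comp.mk_ract (X := id M) x l (1 : M)).trans ?_
    exact congrArg (fun t : M => (comp.mk x t : (comp X (id M)).carrier)) (mul_one l)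
  · intro x; exact X.ract_one x

theorem res_comp_res [Finite L] [Finite M] (ψ : H →* L) (φ : L →* M) :
    IsIso (comp (res ψ) (res φ)) (res (φ.comp ψ)) := res_comp _ _

/-! ### External products -/

/-- The external product of two bisets. -/
abbrev prod (Y : Biset L K) (X : Biset H M) : Biset (L × H) (K × M) where
  carrier := Y.carrier × X.carrier
  finite := by
    have := X.finite
    have := Y.finite
    infer_instance
  lact l p := (Y.lact l.1 p.1, X.lact l.2 p.2)
  ract p k := (Y.ract p.1 k.1, X.ract p.2 k.2)
  one_lact _ := by simp
  mul_lact _ _ _ := by simp [mul_lact]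
  ract_one _ := by simp
  ract_mul _ _ _ := by simp [ract_mul]
  lact_ract _ _ _ := by simp [lact_ract]

theorem prod_congr {Y Y' : Biset L K} {X X' : Biset H M} : IsIso Y Y' → IsIso X X' →
    IsIso (prod Y X) (prod Y' X') := by
  rintro ⟨e, h1, h2⟩ ⟨f, h3, h4⟩
  refine ⟨Equiv.prodCongr e f, ?_, ?_⟩
  · rintro k ⟨y, x⟩
    exact Prod.ext (h1 _ _) (h3 _ _)
  · rintro ⟨y, x⟩ k
    exact Prod.ext (h2 _ _) (h4 _ _)

theorem sum_prod (Y Y' : Biset L K) (X : Biset H M) :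
    IsIso (prod (sum Y Y') X) (sum (prod Y X) (prod Y' X)) := by
  refine ⟨Equiv.sumProdDistrib _ _ _, ?_, ?_⟩
  · rintro k ⟨y | y, x⟩ <;> rfl
  · rintro ⟨y | y, x⟩ k <;> rfl

theorem prod_sum (Y : Biset L K) (X X' : Biset H M) :
    IsIso (prod Y (sum X X')) (sum (prod Y X) (prod Y X')) := by
  refine ⟨Equiv.prodSumDistrib _ _ _, ?_, ?_⟩
  · rintro k ⟨y, x | x⟩ <;> rfl
  · rintro ⟨y, x | x⟩ k <;> rfl

theorem prod_comp_prod {L' K' H' : Type u} [Group L'] [Group K'] [Group H']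
    (Y : Biset L K) (X : Biset K H) (Y' : Biset L' K') (X' : Biset K' H') :
    IsIso (comp (prod Y Y') (prod X X')) (prod (comp Y X) (comp Y' X')) := by
  have key : ∀ (y : Y.carrier) (y' : Y'.carrier) (k : K) (k' : K') (x : X.carrier)
      (x' : X'.carrier),
      (comp.mk (Y.ract y k, Y'.ract y' k') (x, x') : (comp (prod Y Y') (prod X X')).carrier) =
        comp.mk (y, y') (X.lact k x, X'.lact k' x') := fun y y' k k' x x' =>
    comp.mk_ract (Y := prod Y Y') (X := prod X X') (y, y') (k, k') (x, x')
  refine comp_isIso (Y := prod Y Y') (X := prod X X') (Z := prod (comp Y X) (comp Y' X'))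
    (fun y x => (comp.mk y.1 x.1, comp.mk y.2 x.2))
    (fun z => comp.lift (fun y x => comp.lift (fun y' x' => comp.mk (y, y') (x, x'))
      (fun y' k' x' => ?_) z.2) (fun y k x => ?_) z.1) ?_ ?_ ?_ ?_ ?_
  · have := key y y' 1 k' x x'
    simpa using this
  · obtain ⟨z1, z2⟩ := z
    induction z2 using comp.ind with | h y' x' =>
    have := key y y' k 1 x x'
    simpa using this
  · intro y k x
    exact Prod.ext (comp.mk_ract _ _ _) (comp.mk_ract _ _ _)
  · intro y k x; rfl
  · intro y k x; rfl
  · intro y x; rfl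
  · rintro ⟨z1, z2⟩
    induction z1 using comp.ind with | h y x =>
    induction z2 using comp.ind with | h y' x' => rfl

theorem res_prod_res [Finite K] [Finite M] (φ : L →* K) (ψ : H →* M) :
    IsIso (prod (res φ) (res ψ)) (res (φ.prodMap ψ)) :=
  ⟨Equiv.refl _, fun _ _ => rfl, fun _ _ => rfl⟩

/-! ### The bisets used in the theory of Green biset functors -/

/-- The opposite biset. -/
abbrev op (X : Biset K H) : Biset H K where
  carrier := X.carrier
  finite := X.finite
  lact h x := X.ract x h⁻¹
  ract x k := X.lact k⁻¹ x
  one_lact _ := by simp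
  mul_lact _ _ _ := by simp [ract_mul]
  ract_one _ := by simp
  ract_mul _ _ _ := by simp [mul_lact]
  lact_ract _ _ _ := by simp [lact_ract]

variable (H) in
/-- The `(H × H, 1)`-biset `H` with `(h₁, h₂) · h = h₁ h h₂⁻¹`. -/
abbrev arrow [Finite H] : Biset (H × H) PUnit.{u + 1} where
  carrier := H
  finite := inferInstance
  lact p h := p.1 * h * p.2⁻¹
  ract h _ := h
  one_lact _ := by simp
  mul_lact _ _ _ := by simp [mul_assoc]
  ract_one _ := rfl
  ract_mul _ _ _ := rfl
  lact_ract _ _ _ := rfl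

/-- The biset `L × ←K × H`, where `←K` is the opposite of the biset `arrow K`, seen as an
`(L × H, (L × K) × (K × H))`-biset through the canonical identifications of
`L × H` with `(L × 1) × H` and of `(L × K) × (K × H)` with `(L × (K × K)) × H`. -/
abbrev contract (L K H : Type u) [Group L] [Group K] [Group H] [Finite L] [Finite K] [Finite H] :
    Biset (L × H) ((L × K) × (K × H)) :=
  corestrict
    (restrict (L := (L × PUnit.{u + 1}) × H)
      { toFun := fun p => ((p.1, 1), p.2)
        map_one' := rfl
        map_mul' := fun _ _ => rfl }
      (prod (prod (id L) (op (arrow K))) (id H)))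
    { toFun := fun p => ((p.1.1, (p.1.2, p.2.1)), p.2.2)
      map_one' := rfl
      map_mul' := fun _ _ => rfl }

/-- The biset `K × ←H`, seen as a `(K, (K × H) × H)`-biset through the canonical identifications
of `K` with `K × 1` and of `(K × H) × H` with `K × (H × H)`. -/
abbrev contractRight (K H : Type u) [Group K] [Group H] [Finite K] [Finite H] :
    Biset K ((K × H) × H) :=
  corestrict
    (restrict (L := K × PUnit.{u + 1})
      { toFun := fun k => (k, 1)
        map_one' := rfl
        map_mul' := fun _ _ => rfl }
      (prod (id K) (op (arrow H))))
    { toFun := fun p => (p.1.1, (p.1.2, p.2))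
      map_one' := rfl
      map_mul' := fun _ _ => rfl }

/-- The canonical isomorphism `L × (K × H) ≃* (L × K) × H`. -/
abbrev assocEquiv (L K H : Type u) [Group L] [Group K] [Group H] :
    L × (K × H) ≃* (L × K) × H := MulEquiv.prodAssoc.symm

variable (H) in
/-- The canonical isomorphism `1 × H ≃* H`. -/
abbrev lambdaEquiv : PUnit.{u + 1} × H ≃* H := MulEquiv.uniqueProd

variable (H) in
/-- The canonical isomorphism `H × 1 ≃* H`. -/
abbrev rhoEquiv : H × PUnit.{u + 1} ≃* H := MulEquiv.prodUnique

theorem mk_eq {Y : Biset L K} {X : Biset K H} (k : K) {y y' : Y.carrier} {x x' : X.carrier}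
    (h1 : y' = Y.ract y k⁻¹) (h2 : x' = X.lact k x) :
    (comp.mk y x : (comp Y X).carrier) = comp.mk y' x' :=
  Quotient.sound (s := compSetoid Y X) ⟨k, Prod.ext h1 h2⟩

section contract
variable [Finite L] [Finite K] [Finite H] [Finite M]

/-- Auxiliary biset describing a double contraction. -/
abbrev contract₂ : Biset (M × H) ((M × L) × ((L × K) × (K × H))) where
  carrier := M × L × K × H
  finite := inferInstance
  lact p x := (p.1 * x.1, x.2.1, x.2.2.1, p.2 * x.2.2.2)
  ract x p := (x.1 * p.1.1, p.1.2⁻¹ * x.2.1 * p.2.1.1, p.2.1.2⁻¹ * x.2.2.1 * p.2.2.1,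
    x.2.2.2 * p.2.2.2)
  one_lact _ := by simp
  mul_lact _ _ _ := by simp [mul_assoc]
  ract_one _ := by simp
  ract_mul _ _ _ := by simp [mul_assoc]
  lact_ract _ _ _ := by simp [mul_assoc]

theorem contract_left : IsIso
    (comp (contract M L H) (prod (id (M × L)) (contract L K H)))
    (contract₂ (M := M) (L := L) (K := K) (H := H)) := by
  refine comp_isIso (Y := contract M L H) (X := prod (id (M × L)) (contract L K H))
    (Z := contract₂ (M := M) (L := L) (K := K) (H := H))
    (fun y x => (y.1.1 * x.1.1, x.1.2⁻¹ * y.1.2 * x.2.1.1, x.2.1.2, y.2 * x.2.2))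
    (fun z => comp.mk (Y := contract M L H) (X := prod (id (M × L)) (contract L K H))
      ((z.1, z.2.1), z.2.2.2) (1, ((1, z.2.2.1), 1)))
    ?_ ?_ ?_ ?_ ?_
  · rintro ⟨⟨m, l⟩, h⟩ ⟨⟨m1, l1⟩, l2, h1⟩ ⟨⟨m2, l3⟩, ⟨l4, k⟩, h2⟩
    simp [mul_assoc]
  · rintro ⟨m0, h0⟩ ⟨⟨m, l⟩, h⟩ ⟨⟨m2, l3⟩, ⟨l4, k⟩, h2⟩
    simp [mul_assoc]
  · rintro ⟨⟨m, l⟩, h⟩ ⟨⟨m2, l3⟩, ⟨l4, k⟩, h2⟩ ⟨⟨m1, l1⟩, ⟨l5, k5⟩, k6, h6⟩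
    simp [mul_assoc]
  · rintro ⟨⟨m, l⟩, h⟩ ⟨⟨m2, l3⟩, ⟨l4, k⟩, h2⟩
    refine mk_eq ((m2, l3), (l4, h2)) ?_ ?_ <;> simp [mul_assoc]
  · rintro ⟨m, l, k, h⟩
    simp

theorem contract_right : IsIso
    (comp (comp (contract M K H) (prod (contract M L K) (id (K × H))))
      (iso (assocEquiv (M × L) (L × K) (K × H))))
    (contract₂ (M := M) (L := L) (K := K) (H := H)) := by
  refine (comp_ind _ _).trans ?_
  have : IsIso (comp (contract M K H) (prod (contract M L K) (id (K × H))))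
      (corestrict (contract₂ (M := M) (L := L) (K := K) (H := H))
        (assocEquiv (M × L) (L × K) (K × H)).symm.toMonoidHom) := by
    refine comp_isIso (Y := contract M K H) (X := prod (contract M L K) (id (K × H)))
      (fun y x => (y.1.1 * x.1.1.1, x.1.1.2, x.1.2⁻¹ * y.1.2 * x.2.1, y.2 * x.2.2))
      (fun z => comp.mk (Y := contract M K H) (X := prod (contract M L K) (id (K × H)))
        ((z.1, z.2.2.1), z.2.2.2) (((1, z.2.1), 1), 1))
      ?_ ?_ ?_ ?_ ?_
    · rintro ⟨⟨m, l⟩, h⟩ ⟨⟨m1, l1⟩, l2, h1⟩ ⟨⟨⟨m2, l3⟩, k⟩, k4, h2⟩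
      simp [mul_assoc]
    · rintro ⟨m0, h0⟩ ⟨⟨m, l⟩, h⟩ ⟨⟨⟨m2, l3⟩, k⟩, k4, h2⟩
      simp [mul_assoc]
    · rintro ⟨⟨m, l⟩, h⟩ ⟨⟨⟨m2, l3⟩, k⟩, k4, h2⟩ ⟨⟨⟨m1, l1⟩, ⟨l5, k5⟩⟩, k6, h6⟩
      simp [mul_assoc]
    · rintro ⟨⟨m, l⟩, h⟩ ⟨⟨⟨m2, l3⟩, k⟩, k4, h2⟩
      refine mk_eq ((m2, k), (k4, h2)) ?_ ?_ <;> simp [mul_assoc]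
    · rintro ⟨m, l, k, h⟩
      simp
  obtain ⟨e, h1, h2⟩ := this
  exact ⟨e, h1, fun x h => h2 x _⟩

theorem contract_assoc : IsIso
    (comp (contract M L H) (prod (id (M × L)) (contract L K H)))
    (comp (comp (contract M K H) (prod (contract M L K) (id (K × H))))
      (iso (assocEquiv (M × L) (L × K) (K × H)))) :=
  contract_left.trans contract_right.symm

theorem contract_id_left : IsIso
    (comp (contract K K H) (prod (arrow K) (id (K × H)))) (iso (lambdaEquiv (K × H))) := by
  refine comp_isIso (Y := contract K K H) (X := prod (arrow K) (id (K × H)))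
    (Z := iso (lambdaEquiv (K × H)))
    (fun y x => (y.1.1 * x.1 * y.1.2 * x.2.1, y.2 * x.2.2))
    (fun z => comp.mk (Y := contract K K H) (X := prod (arrow K) (id (K × H)))
      ((z.1, 1), z.2) (1, 1))
    ?_ ?_ ?_ ?_ ?_
  · rintro ⟨⟨m, l⟩, h⟩ ⟨⟨m1, l1⟩, l2, h1⟩ ⟨k, k4, h2⟩
    simp [mul_assoc]
  · rintro ⟨m0, h0⟩ ⟨⟨m, l⟩, h⟩ ⟨k, k4, h2⟩
    simp [mul_assoc]
  · rintro ⟨⟨m, l⟩, h⟩ ⟨k, k4, h2⟩ ⟨_, k6, h6⟩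
    simp [mul_assoc]
  · rintro ⟨⟨m, l⟩, h⟩ ⟨k, k4, h2⟩
    refine mk_eq ((k * l * k4, l * k4), (k4, h2)) ?_ ?_ <;> simp [mul_assoc]
  · rintro ⟨k, h⟩
    simp

theorem contract_id_right : IsIso
    (comp (contract K H H) (prod (id (K × H)) (arrow H))) (iso (rhoEquiv (K × H))) := by
  refine comp_isIso (Y := contract K H H) (X := prod (id (K × H)) (arrow H))
    (Z := iso (rhoEquiv (K × H)))
    (fun y x => (y.1.1 * x.1.1, y.2 * x.2⁻¹ * y.1.2⁻¹ * x.1.2))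
    (fun z => comp.mk (Y := contract K H H) (X := prod (id (K × H)) (arrow H))
      ((z.1, 1), z.2) (1, 1))
    ?_ ?_ ?_ ?_ ?_
  · rintro ⟨⟨m, l⟩, h⟩ ⟨⟨m1, l1⟩, l2, h1⟩ ⟨⟨k4, h2⟩, k⟩
    simp [mul_assoc]
  · rintro ⟨m0, h0⟩ ⟨⟨m, l⟩, h⟩ ⟨⟨k4, h2⟩, k⟩
    simp [mul_assoc]
  · rintro ⟨⟨m, l⟩, h⟩ ⟨⟨k4, h2⟩, k⟩ ⟨⟨k6, h6⟩, _⟩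
    simp [mul_assoc]
  · rintro ⟨⟨m, l⟩, h⟩ ⟨⟨k4, h2⟩, k⟩
    refine mk_eq ((k4, h2), (l⁻¹ * h2, k⁻¹ * l⁻¹ * h2)) ?_ ?_ <;> simp [mul_assoc]
  · rintro ⟨k, h⟩
    simp

/-- Auxiliary biset describing a double contraction. -/
abbrev contractRight₂ : Biset L ((L × K) × ((K × H) × H)) where
  carrier := L × K × H
  finite := inferInstance
  lact p x := (p * x.1, x.2.1, x.2.2)
  ract x p := (x.1 * p.1.1, p.1.2⁻¹ * x.2.1 * p.2.1.1, p.2.1.2⁻¹ * x.2.2 * p.2.2)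
  one_lact _ := by simp
  mul_lact _ _ _ := by simp [mul_assoc]
  ract_one _ := by simp
  ract_mul _ _ _ := by simp [mul_assoc]
  lact_ract _ _ _ := by simp [mul_assoc]

theorem contractRight_assoc : IsIso
    (comp (contractRight L K) (prod (id (L × K)) (contractRight K H)))
    (comp (comp (contractRight L H) (prod (contract L K H) (id H)))
      (iso (assocEquiv (L × K) (K × H) H))) := by
  refine IsIso.trans (Y := contractRight₂ (L := L) (K := K) (H := H)) ?_
    (IsIso.symm ((comp_ind _ _).trans ?_))
  · refine comp_isIso (Y := contractRight L K) (X := prod (id (L × K)) (contractRight K H))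
      (Z := contractRight₂ (L := L) (K := K) (H := H))
      (fun y x => (y.1 * x.1.1, x.1.2⁻¹ * y.2 * x.2.1, x.2.2))
      (fun z => comp.mk (Y := contractRight L K) (X := prod (id (L × K)) (contractRight K H))
        (z.1, z.2.1) (1, (1, z.2.2)))
      ?_ ?_ ?_ ?_ ?_
    · rintro ⟨m, l⟩ ⟨⟨m1, l1⟩, l2⟩ ⟨⟨m2, l3⟩, ⟨l4, k⟩⟩
      simp [mul_assoc]
    · rintro m0 ⟨m, l⟩ ⟨⟨m2, l3⟩, ⟨l4, k⟩⟩
      simp [mul_assoc]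
    · rintro ⟨m, l⟩ ⟨⟨m2, l3⟩, ⟨l4, k⟩⟩ ⟨⟨m1, l1⟩, ⟨l5, k5⟩, h6⟩
      simp [mul_assoc]
    · rintro ⟨m, l⟩ ⟨⟨m2, l3⟩, ⟨l4, k⟩⟩
      refine mk_eq ((m2, l3), l4) ?_ ?_ <;> simp [mul_assoc]
    · rintro ⟨m, l, k⟩
      simp
  · have : IsIso (comp (contractRight L H) (prod (contract L K H) (id H)))
        (corestrict (contractRight₂ (L := L) (K := K) (H := H))
          (assocEquiv (L × K) (K × H) H).symm.toMonoidHom) := by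
      refine comp_isIso (Y := contractRight L H) (X := prod (contract L K H) (id H))
        (fun y x => (y.1 * x.1.1.1, x.1.1.2, x.1.2⁻¹ * y.2 * x.2))
        (fun z => comp.mk (Y := contractRight L H) (X := prod (contract L K H) (id H))
          (z.1, z.2.2) (((1, z.2.1), 1), 1))
        ?_ ?_ ?_ ?_ ?_
      · rintro ⟨m, h⟩ ⟨⟨m1, l1⟩, h1⟩ ⟨⟨⟨m2, l3⟩, k⟩, h2⟩
        simp [mul_assoc]
      · rintro m0 ⟨m, h⟩ ⟨⟨⟨m2, l3⟩, k⟩, h2⟩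
        simp [mul_assoc]
      · rintro ⟨m, h⟩ ⟨⟨⟨m2, l3⟩, k⟩, h2⟩ ⟨⟨⟨m1, l1⟩, ⟨l5, k5⟩⟩, h6⟩
        simp [mul_assoc]
      · rintro ⟨m, h⟩ ⟨⟨⟨m2, l3⟩, k⟩, h2⟩
        refine mk_eq ((m2, k), h2) ?_ ?_ <;> simp [mul_assoc]
      · rintro ⟨m, l, h⟩
        simp
    obtain ⟨e, h1, h2⟩ := this
    exact ⟨e, h1, fun x h => h2 x _⟩

theorem contractRight_id : IsIso
    (comp (contractRight H H) (prod (arrow H) (id H))) (iso (lambdaEquiv H)) := by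
  refine comp_isIso (Y := contractRight H H) (X := prod (arrow H) (id H))
    (Z := iso (lambdaEquiv H))
    (fun y x => y.1 * x.1 * y.2 * x.2)
    (fun z => comp.mk (Y := contractRight H H) (X := prod (arrow H) (id H)) (z, 1) (1, 1))
    ?_ ?_ ?_ ?_ ?_
  · rintro ⟨m, h⟩ ⟨⟨m1, l1⟩, h1⟩ ⟨k, h2⟩
    simp [mul_assoc]
  · rintro m0 ⟨m, h⟩ ⟨k, h2⟩
    simp [mul_assoc]
  · rintro ⟨m, h⟩ ⟨k, h2⟩ ⟨_, h6⟩
    simp [mul_assoc]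
  · rintro ⟨m, l⟩ ⟨k, k4⟩
    refine mk_eq ((k * l * k4, l * k4), k4) ?_ ?_ <;> simp [mul_assoc]
  · intro k
    simp

end contract

/-! ### Shift -/

/-- The homomorphism `(k, h, g) ↦ ((k, g), (h, g))` which is diagonal on the last factor. -/
def diag (K H M : Type u) [Group K] [Group H] [Group M] :
    (K × H) × M →* (K × M) × (H × M) where
  toFun p := ((p.1.1, p.2), (p.1.2, p.2))
  map_one' := rfl
  map_mul' _ _ := rfl

theorem diag_natural [Finite K] [Finite H] [Finite L] [Finite T] [Finite M]
    (Y : Biset T K) (X : Biset L H) :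
    IsIso (comp (prod (prod Y X) (id M)) (res (diag K H M)))
      (comp (res (diag T L M)) (prod (prod Y (id M)) (prod X (id M)))) := by
  refine IsIso.trans ?_ (res_comp _ _).symm
  refine comp_isIso (Y := prod (prod Y X) (id M)) (X := res (diag K H M))
    (fun p q => ((Y.ract p.1.1 q.1.1, p.2 * q.1.2), (X.ract p.1.2 q.2.1, p.2 * q.2.2)))
    (fun z => comp.mk (Y := prod (prod Y X) (id M)) (X := res (diag K H M))
      ((z.1.1, z.2.1), z.1.2) ((1, 1), (1, z.1.2⁻¹ * z.2.2)))
    ?_ ?_ ?_ ?_ ?_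
  · rintro ⟨⟨y, x⟩, g⟩ ⟨⟨k, h⟩, g'⟩ ⟨⟨k1, g1⟩, h1, g2⟩
    simp [diag, ract_mul, mul_assoc]
  · rintro ⟨⟨t, l⟩, g'⟩ ⟨⟨y, x⟩, g⟩ ⟨⟨k1, g1⟩, h1, g2⟩
    simp [diag, lact_ract, mul_assoc]
  · rintro ⟨⟨y, x⟩, g⟩ ⟨⟨k1, g1⟩, h1, g2⟩ ⟨⟨k, g'⟩, h, g''⟩
    simp [ract_mul, mul_assoc]
  · rintro ⟨⟨y, x⟩, g⟩ ⟨⟨k1, g1⟩, h1, g2⟩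
    refine mk_eq ((k1, h1), g1) ?_ ?_ <;> simp [diag, mul_assoc, ← ract_mul]
  · rintro ⟨⟨y, g⟩, x, g'⟩
    simp

theorem inf_natural [Finite K] [Finite H] [Finite M] (X : Biset K H) :
    IsIso (comp (res (MonoidHom.fst K M)) X)
      (comp (prod X (id M)) (res (MonoidHom.fst H M))) := by
  refine (res_comp _ _).trans (IsIso.symm ?_)
  refine comp_isIso (Y := prod X (id M)) (X := res (MonoidHom.fst H M))
    (fun p h => X.ract p.1 h)
    (fun z => comp.mk (Y := prod X (id M)) (X := res (MonoidHom.fst H M)) (z, 1) 1)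
    ?_ ?_ ?_ ?_ ?_
  · rintro ⟨x, g⟩ ⟨h, g'⟩ h'
    simp [ract_mul]
  · rintro ⟨k, g⟩ ⟨x, g'⟩ h
    simp [lact_ract]
  · rintro ⟨x, g'⟩ h h'
    simp [ract_mul]
  · rintro ⟨x, g⟩ h
    refine mk_eq (h, g⁻¹) ?_ ?_ <;> simp [← ract_mul]
  · intro x
    simp

theorem res_natural [Finite K] [Finite H] [Finite M] (X : Biset K H) :
    IsIso (comp (res (MonoidHom.inl K M)) (prod X (id M)))
      (comp X (res (MonoidHom.inl H M))) := by
  refine (res_comp _ _).trans (IsIso.symm ?_)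
  refine comp_isIso (Y := X) (X := res (MonoidHom.inl H M))
    (fun x p => (X.ract x p.1, p.2))
    (fun z => comp.mk (Y := X) (X := res (MonoidHom.inl H M)) z.1 (1, z.2))
    ?_ ?_ ?_ ?_ ?_
  · rintro x h ⟨h', g'⟩
    simp [ract_mul]
  · rintro k x ⟨h', g'⟩
    simp [lact_ract]
  · rintro x ⟨h', g'⟩ ⟨h, g⟩
    simp [ract_mul]
  · rintro x ⟨h, g⟩
    refine mk_eq h ?_ ?_ <;> simp [← ract_mul]
  · rintro ⟨x, g⟩
    simp

end

end Biset

/-! ## Burnside groups and the biset category -/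

/-- Isomorphism classes of finite `(K, H)`-bisets. -/
def IsoClass (K H : Type u) [Group K] [Group H] : Type (u + 1) := Quotient (Biset.setoid K H)

section
variable {K H L M K' H' : Type u} [Group K] [Group H] [Group L] [Group M] [Group K'] [Group H']

/-- The sum of isomorphism classes of bisets is given by disjoint union. -/
instance : Add (IsoClass K H) :=
  ⟨Quotient.map₂ Biset.sum fun _ _ h _ _ h' => Biset.sum_congr h h'⟩

instance : Zero (IsoClass K H) := ⟨Quotient.mk _ (Biset.empty K H)⟩

instance : AddCommMonoid (IsoClass K H) where
  add_assoc := by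
    rintro ⟨X⟩ ⟨Y⟩ ⟨Z⟩
    exact Quotient.sound (Biset.sum_assoc X Y Z)
  zero_add := by
    rintro ⟨X⟩
    exact Quotient.sound (Biset.empty_sum X)
  add_zero := by
    rintro ⟨X⟩
    exact Quotient.sound ((Biset.sum_comm _ _).trans (Biset.empty_sum X))
  add_comm := by
    rintro ⟨X⟩ ⟨Y⟩
    exact Quotient.sound (Biset.sum_comm X Y)
  nsmul := nsmulRec

/-- The Grothendieck group `B(K, H)` of the category of finite `(K, H)`-bisets. -/
abbrev Burnside (K H : Type u) [Group K] [Group H] : Type (u + 1) :=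
  Algebra.GrothendieckAddGroup (IsoClass K H)

variable (k : Type w) [CommRing k]

/-- The `k`-linearization `kB(K, H) = k ⊗ B(K, H)`. -/
abbrev LinBurnside (K H : Type u) [Group K] [Group H] : Type (max w (u + 1)) :=
  k ⊗[ℤ] Burnside K H

/-- The isomorphism class of a biset. -/
def IsoClass.mk (X : Biset K H) : IsoClass K H := Quotient.mk _ X

/-- The class of a biset in `kB(K, H)`. -/
noncomputable def cls (X : Biset K H) : LinBurnside k K H :=
  (1 : k) ⊗ₜ Algebra.GrothendieckAddGroup.of (IsoClass.mk X)

theorem cls_eq {X Y : Biset K H} (h : X.IsIso Y) : cls k X = cls k Y := by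
  have : IsoClass.mk X = IsoClass.mk Y := Quotient.sound h
  simp only [cls, this]

theorem cls_sum (X Y : Biset K H) : cls k (X.sum Y) = cls k X + cls k Y := by
  have : IsoClass.mk (X.sum Y) = IsoClass.mk X + IsoClass.mk Y := rfl
  simp only [cls, this, map_add, TensorProduct.tmul_add]

variable {k} {V W : Type*} [AddCommGroup V] [Module k V] [AddCommGroup W] [Module k W]

theorem linBurnside_ext {f g : LinBurnside k K H →ₗ[k] V} (h : ∀ X, f (cls k X) = g (cls k X)) :
    f = g := by
  refine TensorProduct.AlgebraTensorModule.curry_injective (LinearMap.ext_ring ?_)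
  have : (TensorProduct.AlgebraTensorModule.curry f 1).toAddMonoidHom =
      (TensorProduct.AlgebraTensorModule.curry g 1).toAddMonoidHom := by
    apply Algebra.GrothendieckAddGroup.lift.symm.injective
    ext x
    induction x using Quotient.inductionOn with | h X => exact h X
  exact LinearMap.toAddMonoidHom_injective this

theorem linBurnside_ext₂ {f g : LinBurnside k K H →ₗ[k] LinBurnside k K' H' →ₗ[k] V}
    (h : ∀ X Y, f (cls k X) (cls k Y) = g (cls k X) (cls k Y)) : f = g :=
  linBurnside_ext fun X => linBurnside_ext fun Y => h X Y

/-- The linear extension of an additive invariant of bisets. -/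
noncomputable def linExtend (f : Biset K H → V) (hf : ∀ X Y, X.IsIso Y → f X = f Y)
    (hadd : ∀ X Y, f (X.sum Y) = f X + f Y) : LinBurnside k K H →ₗ[k] V :=
  LinearMap.liftBaseChange k (AddMonoidHom.toIntLinearMap (Algebra.GrothendieckAddGroup.lift
    { toFun := Quotient.lift f hf
      map_zero' := by
        have h := hadd (Biset.empty K H) (Biset.empty K H)
        rw [hf _ _ (Biset.empty_sum _)] at h
        exact left_eq_add.mp h
      map_add' := by
        rintro ⟨X⟩ ⟨Y⟩
        exact hadd X Y }))

@[simp] theorem linExtend_cls (f : Biset K H → V) (hf) (hadd) (X : Biset K H) :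
    linExtend (k := k) f hf hadd (cls k X) = f X := by
  simp only [linExtend, cls, LinearMap.liftBaseChange_tmul, one_smul,
    AddMonoidHom.coe_toIntLinearMap]
  exact DFunLike.congr_fun (Algebra.GrothendieckAddGroup.lift.symm_apply_apply _) _

/-- The bilinear extension of a biadditive operation on bisets. -/
noncomputable def linExtend₂ (f : Biset K H → Biset K' H' → Biset L M)
    (hf : ∀ X X' Y Y', X.IsIso X' → Y.IsIso Y' → (f X Y).IsIso (f X' Y'))
    (hl : ∀ X X' Y, (f (X.sum X') Y).IsIso ((f X Y).sum (f X' Y)))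
    (hr : ∀ X Y Y', (f X (Y.sum Y')).IsIso ((f X Y).sum (f X Y'))) :
    LinBurnside k K H →ₗ[k] LinBurnside k K' H' →ₗ[k] LinBurnside k L M :=
  linExtend
    (fun X => linExtend (fun Y => cls k (f X Y))
      (fun Y Y' h => cls_eq k (hf X X Y Y' (Biset.IsIso.refl X) h))
      (fun Y Y' => (cls_eq k (hr X Y Y')).trans (cls_sum k _ _)))
    (fun X X' h => linBurnside_ext fun Y => by
      simpa using cls_eq k (hf X X' Y Y h (Biset.IsIso.refl Y)))
    (fun X X' => linBurnside_ext fun Y => by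
      simpa using (cls_eq k (hl X X' Y)).trans (cls_sum k _ _))

@[simp] theorem linExtend₂_cls (f : Biset K H → Biset K' H' → Biset L M) (hf) (hl) (hr) (X Y) :
    linExtend₂ (k := k) f hf hl hr (cls k X) (cls k Y) = cls k (f X Y) := by
  simp [linExtend₂]

/-- The bilinear composition `kB(L, K) × kB(K, H) → kB(L, H)` induced by the composition of
bisets. -/
noncomputable def compB : LinBurnside k L K →ₗ[k] LinBurnside k K H →ₗ[k] LinBurnside k L H :=
  linExtend₂ Biset.comp (fun _ _ _ _ => Biset.comp_congr) Biset.sum_comp Biset.comp_sum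

@[simp] theorem compB_cls (Y : Biset L K) (X : Biset K H) :
    compB (cls k Y) (cls k X) = cls k (Y.comp X) := linExtend₂_cls _ _ _ _ _ _

/-- The bilinear external product `kB(L, K) × kB(H, M) → kB(L × H, K × M)` induced by the external
product of bisets. -/
noncomputable def prodB :
    LinBurnside k L K →ₗ[k] LinBurnside k H M →ₗ[k] LinBurnside k (L × H) (K × M) :=
  linExtend₂ Biset.prod (fun _ _ _ _ => Biset.prod_congr) Biset.sum_prod Biset.prod_sum

@[simp] theorem prodB_cls (Y : Biset L K) (X : Biset H M) :
    prodB (cls k Y) (cls k X) = cls k (Y.prod X) := linExtend₂_cls _ _ _ _ _ _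

theorem compB_assoc (γ : LinBurnside k M L) (β : LinBurnside k L K) (α : LinBurnside k K H) :
    compB (compB γ β) α = compB γ (compB β α) := by
  have h1 : ∀ Z Y X, compB (compB (cls k Z) (cls k Y)) (cls k X) =
      compB (cls k Z : LinBurnside k M L) (compB (cls k Y : LinBurnside k L K)
        (cls k X : LinBurnside k K H)) := fun Z Y X => by
    simpa using cls_eq k (Biset.comp_assoc Z Y X)
  have h2 : ∀ Z Y, compB (compB (cls k Z) (cls k Y)) =
      (compB (cls k Z : LinBurnside k M L)).comp (compB (cls k Y : LinBurnside k L K) :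
        LinBurnside k K H →ₗ[k] _) := fun Z Y => linBurnside_ext fun X => h1 Z Y X
  have h3 : ∀ Z, (compB.flip α).comp (compB (cls k Z)) =
      (compB (cls k Z : LinBurnside k M L)).comp (compB.flip α : LinBurnside k L K →ₗ[k] _) :=
    fun Z => linBurnside_ext fun Y => DFunLike.congr_fun (h2 Z Y) α
  have h4 : (compB.flip α).comp (compB.flip β) =
      (compB.flip (compB β α) : LinBurnside k M L →ₗ[k] _) :=
    linBurnside_ext fun Z => by
      have := DFunLike.congr_fun (h3 Z) β
      simpa using this
  exact DFunLike.congr_fun h4 γ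

theorem id_compB [Finite K] (α : LinBurnside k K H) : compB (cls k (Biset.id K)) α = α := by
  have : compB (cls k (Biset.id K)) = (LinearMap.id : LinBurnside k K H →ₗ[k] _) :=
    linBurnside_ext fun X => by simpa using cls_eq k (Biset.id_comp X)
  exact DFunLike.congr_fun this α

theorem compB_id [Finite H] (α : LinBurnside k K H) : compB α (cls k (Biset.id H)) = α := by
  have : compB.flip (cls k (Biset.id H)) = (LinearMap.id : LinBurnside k K H →ₗ[k] _) :=
    linBurnside_ext fun X => by simpa using cls_eq k (Biset.comp_id X)
  exact DFunLike.congr_fun this α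

theorem prodB_id [Finite K] [Finite H] :
    prodB (cls k (Biset.id K)) (cls k (Biset.id H)) = cls k (Biset.id (K × H)) := by
  rw [prodB_cls]
  exact cls_eq k (Biset.res_prod_res _ _)

/-- `α ↦ α × Id_M` is compatible with composition. -/
theorem prodB_compB_id [Finite M] (β : LinBurnside k L K) (α : LinBurnside k K H) :
    prodB (compB β α) (cls k (Biset.id M)) =
      compB (prodB β (cls k (Biset.id M))) (prodB α (cls k (Biset.id M))) := by
  have h : ∀ Y X, prodB (compB (cls k Y : LinBurnside k L K) (cls k X : LinBurnside k K H))
      (cls k (Biset.id M)) =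
        compB (prodB (cls k Y) (cls k (Biset.id M))) (prodB (cls k X) (cls k (Biset.id M))) :=
    fun Y X => by
      simp only [compB_cls, prodB_cls]
      exact cls_eq k (((Biset.prod_comp_prod Y X (Biset.id M) (Biset.id M)).trans
        (Biset.prod_congr (Biset.IsIso.refl _) (Biset.id_comp _))).symm)
  have h2 : (compB (k := k)).compr₂ (prodB.flip (cls k (Biset.id M))) =
      (compB (k := k)).compl₁₂ (prodB.flip (cls k (Biset.id M)) : LinBurnside k L K →ₗ[k] _)
        (prodB.flip (cls k (Biset.id M)) : LinBurnside k K H →ₗ[k] _) :=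
    linBurnside_ext₂ fun Y X => h Y X
  exact DFunLike.congr_fun (DFunLike.congr_fun h2 β) α

end

/-- A class of finite groups that is nonempty and contains every group isomorphic to a subquotient
of one of its members or to a product of two of its members. -/
class Admissible (D : ObjectProperty FiniteGrp.{u}) : Prop where
  nonempty : ∃ H, D H
  subquotient : ∀ H : FiniteGrp.{u}, D H → ∀ (S : Subgroup H) (N : Subgroup S) [N.Normal]
    (K : FiniteGrp.{u}), Nonempty (K ≃* S ⧸ N) → D K
  prod : ∀ H K : FiniteGrp.{u}, D H → D K →
    ∀ L : FiniteGrp.{u}, Nonempty (L ≃* H × K) → D L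

/-- The `k`-linearization `kD` of the full subcategory of the biset category on the class `D` of
finite groups. -/
structure BisetCat (k : Type w) [CommRing k] (D : ObjectProperty FiniteGrp.{u}) where
  grp : FiniteGrp.{u}
  mem : D grp

namespace BisetCat
variable {k : Type w} [CommRing k] {D : ObjectProperty FiniteGrp.{u}}

instance : CoeSort (BisetCat k D) (Type u) := ⟨fun H => H.grp⟩

/-- A morphism from `H` to `K` is an element of `kB(K, H)`. -/
noncomputable instance : Category.{max w (u + 1)} (BisetCat k D) where
  Hom H K := LinBurnside k K H
  id H := cls k (Biset.id H)
  comp α β := compB β α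
  id_comp α := compB_id α
  comp_id α := id_compB α
  assoc α β γ := (compB_assoc γ β α).symm

noncomputable instance (H K : BisetCat k D) : AddCommGroup (H ⟶ K) :=
  inferInstanceAs (AddCommGroup (LinBurnside k K H))

noncomputable instance (H K : BisetCat k D) : Module k (H ⟶ K) :=
  inferInstanceAs (Module k (LinBurnside k K H))

noncomputable instance : Preadditive (BisetCat k D) where
  homGroup := inferInstance
  add_comp _ _ _ α α' β := (compB β).map_add α α'
  comp_add _ _ _ α β β' := LinearMap.map_add₂ compB β β' α

noncomputable instance : Linear k (BisetCat k D) where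
  homModule := inferInstance
  smul_comp _ _ _ r α β := (compB β).map_smul r α
  comp_smul _ _ _ α r β := LinearMap.map_smul₂ compB r β α

/-- The morphism given by a biset. -/
noncomputable def ofBiset {H K : BisetCat k D} (X : Biset K H) : H ⟶ K := cls k X

variable [Admissible D]

/-- The product of two groups of the class. -/
def prod (K H : BisetCat k D) : BisetCat k D :=
  ⟨FiniteGrp.of (K × H), Admissible.prod K.grp H.grp K.mem H.mem _ ⟨MulEquiv.refl _⟩⟩

variable (k D) in
/-- The trivial group. -/
def one : BisetCat k D :=
  ⟨FiniteGrp.of PUnit.{u + 1}, by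
    obtain ⟨H, hH⟩ := Admissible.nonempty (D := D)
    refine Admissible.subquotient H hH ⊥ ⊥ _ ⟨?_⟩
    exact
      { toFun := fun _ => 1
        invFun := fun _ => PUnit.unit
        left_inv := fun _ => rfl
        right_inv := fun _ => Subsingleton.elim _ _
        map_mul' := fun _ _ => Subsingleton.elim _ _ }⟩

/-- The external product of morphisms. -/
noncomputable def extProd {K T H L : BisetCat k D} (α : K ⟶ T) (β : H ⟶ L) :
    prod K H ⟶ prod T L :=
  prodB (L := T) (K := K) (H := L) (M := H) α β

/-- The functor `- × G`. -/
noncomputable def prodRight (G : BisetCat k D) : BisetCat k D ⥤ BisetCat k D where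
  obj H := prod H G
  map α := extProd α (𝟙 G)
  map_id _ := prodB_id
  map_comp α β := prodB_compB_id β α

instance (G : BisetCat k D) : (prodRight G).Additive where
  map_add {_ _ α β} := LinearMap.map_add₂ prodB α β _

instance (G : BisetCat k D) : (prodRight G).Linear k where
  map_smul α r := LinearMap.map_smul₂ prodB r α _

end BisetCat

namespace BisetCat
variable {k : Type w} [CommRing k] {D : ObjectProperty FiniteGrp.{u}}

theorem ofBiset_comp {H K L : BisetCat k D} (Y : Biset L K) (X : Biset K H) :
    (ofBiset X : H ⟶ K) ≫ (ofBiset Y : K ⟶ L) = ofBiset (Y.comp X) := compB_cls Y X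

theorem ofBiset_eq {H K : BisetCat k D} {X Y : Biset K H} (h : X.IsIso Y) :
    (ofBiset X : H ⟶ K) = ofBiset Y := cls_eq k h

theorem hom_induction {H K : BisetCat k D} {V : Type*} [AddCommGroup V] [Module k V]
    {f g : (H ⟶ K) →ₗ[k] V} (h : ∀ X : Biset K H, f (ofBiset X) = g (ofBiset X)) (α : H ⟶ K) :
    f α = g α :=
  DFunLike.congr_fun (linBurnside_ext (k := k) (K := K) (H := H) (f := f) (g := g) h) α

/-- Restriction along a group homomorphism. -/
noncomputable def resHomMor {H L : BisetCat k D} (ψ : H →* L) : L ⟶ H := ofBiset (Biset.res ψ)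

theorem resHomMor_comp {H L M : BisetCat k D} (ψ : H →* L) (φ : L →* M) :
    resHomMor φ ≫ resHomMor ψ = (resHomMor (φ.comp ψ) : M ⟶ H) :=
  (ofBiset_comp _ _).trans (ofBiset_eq (Biset.res_comp_res ψ φ))

theorem comp_eq_res {H L M : BisetCat k D} {ψ : H →* L} {φ : L →* M} {α : M ⟶ L} {β : L ⟶ H}
    (hα : α = resHomMor φ) (hβ : β = resHomMor ψ) : α ≫ β = resHomMor (φ.comp ψ) := by
  rw [hα, hβ, resHomMor_comp]

theorem id_eq_res (H : BisetCat k D) : 𝟙 H = resHomMor (MonoidHom.id H) := rfl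

variable [Admissible D]

theorem extProd_ofBiset {K T H L : BisetCat k D} (Y : Biset T K) (X : Biset L H) :
    extProd (ofBiset Y : K ⟶ T) (ofBiset X : H ⟶ L) = ofBiset (Y.prod X) := prodB_cls Y X

variable (k) in
/-- The canonical isomorphism `L × (K × H) ⟶ (L × K) × H`. -/
noncomputable def isoAssoc (L K H : BisetCat k D) : prod L (prod K H) ⟶ prod (prod L K) H :=
  ofBiset (Biset.iso (Biset.assocEquiv L K H))

/-- The canonical isomorphism `1 × H ⟶ H`. -/
noncomputable def isoLambda (H : BisetCat k D) : prod (one k D) H ⟶ H :=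
  ofBiset (Biset.iso (Biset.lambdaEquiv H))

/-- The canonical isomorphism `H × 1 ⟶ H`. -/
noncomputable def isoRho (H : BisetCat k D) : prod H (one k D) ⟶ H :=
  ofBiset (Biset.iso (Biset.rhoEquiv H))

/-- Inflation from `H` to `H × G`, given by the projection `H × G → H`. -/
noncomputable def infMor (G H : BisetCat k D) : H ⟶ prod H G :=
  ofBiset (Biset.res (MonoidHom.fst H G))

/-- Restriction from `H × G` to `H`, given by the inclusion of `H` as `H × 1`. -/
noncomputable def resMor (G H : BisetCat k D) : prod H G ⟶ H :=
  ofBiset (Biset.res (MonoidHom.inl H G))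

/-- Restriction along `(K × H) × G → (K × G) × (H × G)`, diagonal on `G`. -/
noncomputable def diagMor (G K H : BisetCat k D) :
    prod (prod K G) (prod H G) ⟶ prod (prod K H) G :=
  ofBiset (Biset.res (Biset.diag K H G))

/-- The morphism `L × ←K × H`. -/
noncomputable def contractMor (L K H : BisetCat k D) :
    prod (prod L K) (prod K H) ⟶ prod L H :=
  ofBiset (Biset.contract L K H)

/-- The morphism `K × ←H`. -/
noncomputable def contractRightMor (K H : BisetCat k D) : prod (prod K H) H ⟶ K :=
  ofBiset (Biset.contractRight K H)

/-- The morphism `→H`. -/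
noncomputable def arrowMor (H : BisetCat k D) : one k D ⟶ prod H H :=
  ofBiset (Biset.arrow H)

theorem contractMor_assoc (M L K H : BisetCat k D) :
    extProd (𝟙 (prod M L)) (contractMor L K H) ≫ contractMor M L H =
      isoAssoc k (prod M L) (prod L K) (prod K H) ≫
        extProd (contractMor M L K) (𝟙 (prod K H)) ≫ contractMor M K H := by
  refine (congrArg (· ≫ contractMor M L H) (extProd_ofBiset (k := k) (D := D) _ _)).trans
    ((ofBiset_comp _ _).trans (Eq.trans (ofBiset_eq Biset.contract_assoc) ?_))
  refine Eq.symm ((congrArg (fun t => isoAssoc k (prod M L) (prod L K) (prod K H) ≫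
    t ≫ contractMor M K H) (extProd_ofBiset (k := k) (D := D) _ _)).trans ?_)
  exact (congrArg (isoAssoc k (prod M L) (prod L K) (prod K H) ≫ ·) (ofBiset_comp _ _)).trans
    (ofBiset_comp _ _)

theorem contractRightMor_assoc (L K H : BisetCat k D) :
    extProd (𝟙 (prod L K)) (contractRightMor K H) ≫ contractRightMor L K =
      isoAssoc k (prod L K) (prod K H) H ≫
        extProd (contractMor L K H) (𝟙 H) ≫ contractRightMor L H := by
  refine (congrArg (· ≫ contractRightMor L K) (extProd_ofBiset (k := k) (D := D) _ _)).trans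
    ((ofBiset_comp _ _).trans (Eq.trans (ofBiset_eq Biset.contractRight_assoc) ?_))
  refine Eq.symm ((congrArg (fun t => isoAssoc k (prod L K) (prod K H) H ≫
    t ≫ contractRightMor L H) (extProd_ofBiset (k := k) (D := D) _ _)).trans ?_)
  exact (congrArg (isoAssoc k (prod L K) (prod K H) H ≫ ·) (ofBiset_comp _ _)).trans
    (ofBiset_comp _ _)

theorem arrow_contractMor (K H : BisetCat k D) :
    extProd (arrowMor K) (𝟙 (prod K H)) ≫ contractMor K K H = isoLambda (prod K H) :=
  (congrArg (· ≫ contractMor K K H) (extProd_ofBiset (k := k) (D := D) _ _)).trans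
    ((ofBiset_comp _ _).trans (ofBiset_eq Biset.contract_id_left))

theorem contractMor_arrow (K H : BisetCat k D) :
    extProd (𝟙 (prod K H)) (arrowMor H) ≫ contractMor K H H = isoRho (prod K H) :=
  (congrArg (· ≫ contractMor K H H) (extProd_ofBiset (k := k) (D := D) _ _)).trans
    ((ofBiset_comp _ _).trans (ofBiset_eq Biset.contract_id_right))

theorem arrow_contractRightMor (H : BisetCat k D) :
    extProd (arrowMor H) (𝟙 H) ≫ contractRightMor H H = isoLambda H :=
  (congrArg (· ≫ contractRightMor H H) (extProd_ofBiset (k := k) (D := D) _ _)).trans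
    ((ofBiset_comp _ _).trans (ofBiset_eq Biset.contractRight_id))

theorem infMor_natural (G : BisetCat k D) {H K : BisetCat k D} (α : H ⟶ K) :
    α ≫ infMor G K = infMor G H ≫ extProd α (𝟙 G) := by
  refine hom_induction (k := k) (V := H ⟶ prod K G)
    (f := Linear.rightComp k H (infMor G K))
    (g := (Linear.leftComp k (prod K G) (infMor G H)).comp (prodB.flip (cls k (Biset.id G))))
    (fun X => ?_) α
  refine (ofBiset_comp _ _).trans (Eq.trans (ofBiset_eq (Biset.inf_natural X)) ?_)
  exact Eq.symm ((congrArg (infMor G H ≫ ·) (extProd_ofBiset (k := k) (D := D) _ _)).trans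
    (ofBiset_comp _ _))

theorem resMor_natural (G : BisetCat k D) {H K : BisetCat k D} (α : H ⟶ K) :
    extProd α (𝟙 G) ≫ resMor G K = resMor G H ≫ α := by
  refine hom_induction (k := k) (V := prod H G ⟶ K)
    (f := (Linear.rightComp k (prod H G) (resMor G K)).comp (prodB.flip (cls k (Biset.id G))))
    (g := Linear.leftComp k K (resMor G H))
    (fun X => ?_) α
  refine Eq.trans (congrArg (· ≫ resMor G K) (extProd_ofBiset (k := k) (D := D) _ _)) ?_
  exact (ofBiset_comp _ _).trans ((ofBiset_eq (Biset.res_natural X)).trans (ofBiset_comp _ _).symm)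

theorem diagMor_natural (G : BisetCat k D) {K T H L : BisetCat k D} (α : K ⟶ T) (β : H ⟶ L) :
    diagMor G K H ≫ extProd (extProd α β) (𝟙 G) =
      extProd (extProd α (𝟙 G)) (extProd β (𝟙 G)) ≫ diagMor G T L := by
  refine hom_induction (k := k) (V := prod (prod K G) (prod H G) ⟶ prod (prod T L) G)
    (f := (Linear.leftComp k _ (diagMor G K H)).comp
      ((prodB.flip (cls k (Biset.id G))).comp (prodB.flip β)))
    (g := (Linear.rightComp k _ (diagMor G T L)).comp
      ((prodB.flip (extProd β (𝟙 G))).comp (prodB.flip (cls k (Biset.id G)))))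
    (fun Y => ?_) α
  refine hom_induction (k := k) (V := prod (prod K G) (prod H G) ⟶ prod (prod T L) G)
    (f := (Linear.leftComp k _ (diagMor G K H)).comp
      ((prodB.flip (cls k (Biset.id G))).comp (prodB (ofBiset Y : K ⟶ T))))
    (g := (Linear.rightComp k _ (diagMor G T L)).comp
      ((prodB (extProd (ofBiset Y : K ⟶ T) (𝟙 G))).comp (prodB.flip (cls k (Biset.id G)))))
    (fun X => ?_) β
  have h1 : extProd (extProd (ofBiset Y : K ⟶ T) (ofBiset X : H ⟶ L)) (𝟙 G) =
      ofBiset ((Y.prod X).prod (Biset.id G)) :=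
    (congrArg (fun t => extProd t (𝟙 G)) (extProd_ofBiset _ _)).trans (extProd_ofBiset _ _)
  have h2 : extProd (extProd (ofBiset Y : K ⟶ T) (𝟙 G)) (extProd (ofBiset X : H ⟶ L) (𝟙 G)) =
      ofBiset ((Y.prod (Biset.id G)).prod (X.prod (Biset.id G))) :=
    (congrArg₂ (fun s t => extProd s t) (extProd_ofBiset _ _) (extProd_ofBiset _ _)).trans
      (extProd_ofBiset _ _)
  refine (congrArg (diagMor G K H ≫ ·) h1).trans (Eq.trans ?_
    (congrArg (· ≫ diagMor G T L) h2).symm)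
  exact (ofBiset_comp _ _).trans ((ofBiset_eq (Biset.diag_natural Y X)).trans
    (ofBiset_comp _ _).symm)

theorem extProd_resHomMor {H L K M : BisetCat k D} (ψ : H →* L) (φ : K →* M) :
    extProd (resHomMor ψ : L ⟶ H) (resHomMor φ : M ⟶ K) =
      (resHomMor (H := prod H K) (L := prod L M) (ψ.prodMap φ)) :=
  (extProd_ofBiset _ _).trans (ofBiset_eq (Biset.res_prod_res ψ φ))

theorem isoAssoc_eq (L K H : BisetCat k D) : isoAssoc k L K H =
    resHomMor (H := prod (prod L K) H) (L := prod L (prod K H))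
      (Biset.assocEquiv L K H).symm.toMonoidHom :=
  ofBiset_eq (Biset.iso_isIso _)

theorem isoLambda_eq (H : BisetCat k D) : isoLambda H =
    resHomMor (H := H) (L := prod (one k D) H) (Biset.lambdaEquiv H).symm.toMonoidHom :=
  ofBiset_eq (Biset.iso_isIso _)

theorem isoRho_eq (H : BisetCat k D) : isoRho H =
    resHomMor (H := H) (L := prod H (one k D)) (Biset.rhoEquiv H).symm.toMonoidHom :=
  ofBiset_eq (Biset.iso_isIso _)

theorem infMor_eq (G H : BisetCat k D) : infMor G H =
    resHomMor (H := prod H G) (L := H) (MonoidHom.fst H G) := rfl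

theorem resMor_eq (G H : BisetCat k D) : resMor G H =
    resHomMor (H := H) (L := prod H G) (MonoidHom.inl H G) := rfl

theorem diagMor_eq (G K H : BisetCat k D) : diagMor G K H =
    resHomMor (H := prod (prod K H) G) (L := prod (prod K G) (prod H G)) (Biset.diag K H G) := rfl

theorem extProd_eq_res {H L K M : BisetCat k D} {ψ : H →* L} {φ : K →* M} {α : L ⟶ H} {β : M ⟶ K}
    (hα : α = resHomMor ψ) (hβ : β = resHomMor φ) : extProd α β =
      (resHomMor (H := prod H K) (L := prod L M) (ψ.prodMap φ)) := by
  rw [hα, hβ, extProd_resHomMor]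

theorem shift_assoc (G L K H : BisetCat k D) :
    isoAssoc k (prod L G) (prod K G) (prod H G) ≫
        extProd (diagMor G L K) (𝟙 (prod H G)) ≫ diagMor G (prod L K) H =
      extProd (𝟙 (prod L G)) (diagMor G K H) ≫ diagMor G L (prod K H) ≫
        extProd (isoAssoc k L K H) (𝟙 G) :=
  (comp_eq_res (isoAssoc_eq _ _ _) (comp_eq_res (extProd_eq_res (diagMor_eq _ _ _) (id_eq_res _))
    (diagMor_eq _ _ _))).trans
  (comp_eq_res (extProd_eq_res (id_eq_res _) (diagMor_eq _ _ _)) (comp_eq_res (diagMor_eq _ _ _)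
    (extProd_eq_res (isoAssoc_eq _ _ _) (id_eq_res _)))).symm

theorem shift_one_left (G H : BisetCat k D) :
    extProd (infMor G (one k D)) (𝟙 (prod H G)) ≫ diagMor G (one k D) H ≫
      extProd (isoLambda H) (𝟙 G) = isoLambda (prod H G) :=
  (comp_eq_res (extProd_eq_res (infMor_eq _ _) (id_eq_res _)) (comp_eq_res (diagMor_eq _ _ _)
    (extProd_eq_res (isoLambda_eq _) (id_eq_res _)))).trans (isoLambda_eq _).symm

theorem shift_one_right (G H : BisetCat k D) :
    extProd (𝟙 (prod H G)) (infMor G (one k D)) ≫ diagMor G H (one k D) ≫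
      extProd (isoRho H) (𝟙 G) = isoRho (prod H G) :=
  (comp_eq_res (extProd_eq_res (id_eq_res _) (infMor_eq _ _)) (comp_eq_res (diagMor_eq _ _ _)
    (extProd_eq_res (isoRho_eq _) (id_eq_res _)))).trans (isoRho_eq _).symm

theorem infMor_prod (G K H : BisetCat k D) :
    infMor G (prod K H) = extProd (infMor G K) (infMor G H) ≫ diagMor G K H :=
  (infMor_eq _ _).trans
    (comp_eq_res (extProd_eq_res (infMor_eq _ _) (infMor_eq _ _)) (diagMor_eq _ _ _)).symm

theorem resMor_prod (G K H : BisetCat k D) :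
    diagMor G K H ≫ resMor G (prod K H) = extProd (resMor G K) (resMor G H) :=
  (comp_eq_res (diagMor_eq _ _ _) (resMor_eq _ _)).trans
    (extProd_eq_res (resMor_eq _ _) (resMor_eq _ _)).symm

theorem infMor_resMor (G H : BisetCat k D) : infMor G H ≫ resMor G H = 𝟙 H :=
  (comp_eq_res (infMor_eq _ _) (resMor_eq _ _)).trans (id_eq_res _).symm

end BisetCat

open BisetCat

/-! ## Green biset functors -/

/-- A biset functor for `D` over `k`: a `k`-linear functor from `kD` to `k`-modules. -/
structure BisetFunctor (k : Type w) [CommRing k] (D : ObjectProperty FiniteGrp.{u}) where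
  toFunctor : BisetCat k D ⥤ ModuleCat.{v} k
  additive : toFunctor.Additive
  linear : toFunctor.Linear k

namespace BisetFunctor
variable {k : Type w} [CommRing k] {D : ObjectProperty FiniteGrp.{u}} (F : BisetFunctor.{u, v, w} k D)

/-- The value `F(H)`. -/
abbrev obj (H : BisetCat k D) : ModuleCat.{v} k := F.toFunctor.obj H

/-- The linear map `F(α)`. -/
def map {H K : BisetCat k D} (α : H ⟶ K) : F.obj H →ₗ[k] F.obj K := (F.toFunctor.map α).hom

theorem map_map {H K L : BisetCat k D} (α : H ⟶ K) (β : K ⟶ L) (x : F.obj H) :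
    F.map β (F.map α x) = F.map (α ≫ β) x := by
  simp [map]

theorem map_id {H : BisetCat k D} (x : F.obj H) : F.map (𝟙 H) x = x := by
  simp [map]

/-- The map `α ↦ F(α)` as a linear map. -/
def mapₗ (H K : BisetCat k D) : (H ⟶ K) →ₗ[k] F.obj H →ₗ[k] F.obj K where
  toFun := F.map
  map_add' α β := by
    have := F.additive
    simp [map, Functor.map_add]
  map_smul' r α := by
    have := F.linear
    simp [map, Functor.map_smul]

variable [Admissible D]

/-- The biset functor `F` shifted by `G`, with `F_G(H) = F(H × G)` and `F_G(α) = F(α × Id_G)`. -/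
noncomputable def shift (G : BisetCat k D) : BisetFunctor.{u, v, w} k D where
  toFunctor := prodRight G ⋙ F.toFunctor
  additive := by
    have := F.additive
    infer_instance
  linear := by
    have := F.linear
    infer_instance

end BisetFunctor

/-- A Green biset functor: a biset functor with bilinear products `A(K) × A(H) → A(K × H)` and an
element `ε` of `A(1)`, which are associative, unital and functorial. -/
structure GreenBisetFunctor (k : Type w) [CommRing k] (D : ObjectProperty FiniteGrp.{u})
    [Admissible D] extends BisetFunctor.{u, v, w} k D where
  mul (K H : BisetCat k D) :
    toBisetFunctor.obj K →ₗ[k] toBisetFunctor.obj H →ₗ[k] toBisetFunctor.obj (prod K H)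
  ε : toBisetFunctor.obj (one k D)
  mul_assoc : ∀ (L K H : BisetCat k D) (a : toBisetFunctor.obj L) (b : toBisetFunctor.obj K)
    (c : toBisetFunctor.obj H),
    mul (prod L K) H (mul L K a b) c =
      toBisetFunctor.map (isoAssoc k L K H) (mul L (prod K H) a (mul K H b c))
  one_mul : ∀ (H : BisetCat k D) (a : toBisetFunctor.obj H),
    toBisetFunctor.map (isoLambda H) (mul (one k D) H ε a) = a
  mul_one : ∀ (H : BisetCat k D) (a : toBisetFunctor.obj H),
    toBisetFunctor.map (isoRho H) (mul H (one k D) a ε) = a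
  map_mul : ∀ {K T H L : BisetCat k D} (α : K ⟶ T) (β : H ⟶ L) (a : toBisetFunctor.obj K)
    (b : toBisetFunctor.obj H),
    toBisetFunctor.map (extProd α β) (mul K H a b) =
      mul T L (toBisetFunctor.map α a) (toBisetFunctor.map β b)

/-- A morphism of Green biset functors. -/
structure GreenHom {k : Type w} [CommRing k] {D : ObjectProperty FiniteGrp.{u}} [Admissible D]
    (A C : GreenBisetFunctor.{u, v, w} k D) where
  app (H : BisetCat k D) : A.obj H →ₗ[k] C.obj H
  naturality : ∀ {H K : BisetCat k D} (α : H ⟶ K) (a : A.obj H),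
    app K (A.map α a) = C.map α (app H a)
  map_mul : ∀ (K H : BisetCat k D) (a : A.obj K) (b : A.obj H),
    app (prod K H) (A.mul K H a b) = C.mul K H (app K a) (app H b)
  map_one : app (one k D) A.ε = C.ε

section
variable {k : Type w} [CommRing k] {D : ObjectProperty FiniteGrp.{u}} [Admissible D]

namespace GreenBisetFunctor
variable (A : GreenBisetFunctor.{u, v, w} k D)

/-! ### The associated category -/

/-- The associated category `P_A` of a Green biset functor `A`. -/
structure AssocCat (A : GreenBisetFunctor.{u, v, w} k D) where
  grp : BisetCat k D

variable {A}

/-- Composition in the associated category: `β ∘ α = A(L × ←K × H)(β × α)`. -/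
noncomputable def circ {L K H : BisetCat k D} (β : A.obj (prod L K)) (α : A.obj (prod K H)) :
    A.obj (prod L H) :=
  A.map (contractMor L K H) (A.mul (prod L K) (prod K H) β α)

variable (A) in
/-- The identity of `H` in the associated category. -/
noncomputable def ident (H : BisetCat k D) : A.obj (prod H H) := A.map (arrowMor H) A.ε

theorem mul_map_right {K H L : BisetCat k D} (β : H ⟶ L) (a : A.obj K) (b : A.obj H) :
    A.mul K L a (A.map β b) = A.map (extProd (𝟙 K) β) (A.mul K H a b) := by
  rw [A.map_mul, A.map_id]

theorem mul_map_left {K H L : BisetCat k D} (β : H ⟶ L) (a : A.obj H) (b : A.obj K) :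
    A.mul L K (A.map β a) b = A.map (extProd β (𝟙 K)) (A.mul H K a b) := by
  rw [A.map_mul, A.map_id]

theorem map_eq_map {H K : BisetCat k D} {α β : H ⟶ K} (h : α = β) (x : A.obj H) :
    A.map α x = A.map β x := by rw [h]

theorem circ_assoc {M L K H : BisetCat k D} (γ : A.obj (prod M L)) (β : A.obj (prod L K))
    (α : A.obj (prod K H)) : circ (circ γ β) α = circ γ (circ β α) := by
  simp only [circ]
  rw [mul_map_left, mul_map_right, A.map_map, A.map_map, A.mul_assoc, A.map_map]
  exact map_eq_map (contractMor_assoc M L K H).symm _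

theorem ident_circ {K H : BisetCat k D} (α : A.obj (prod K H)) : circ (A.ident K) α = α := by
  simp only [circ, ident]
  rw [mul_map_left, A.map_map, arrow_contractMor]
  exact A.one_mul _ α

theorem circ_ident {K H : BisetCat k D} (α : A.obj (prod K H)) : circ α (A.ident H) = α := by
  simp only [circ, ident]
  rw [mul_map_right, A.map_map, contractMor_arrow]
  exact A.mul_one _ α

/-- The associated category `P_A`: a morphism from `H` to `K` is an element of `A(K × H)`. -/
noncomputable instance : Category.{v} (AssocCat A) where
  Hom H K := A.obj (prod K.grp H.grp)
  id H := A.ident H.grp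
  comp α β := circ β α
  id_comp α := circ_ident α
  comp_id α := ident_circ α
  assoc α β γ := (circ_assoc γ β α).symm

noncomputable instance (H K : AssocCat A) : AddCommGroup (H ⟶ K) :=
  inferInstanceAs (AddCommGroup (A.obj (prod K.grp H.grp)))

noncomputable instance (H K : AssocCat A) : Module k (H ⟶ K) :=
  inferInstanceAs (Module k (A.obj (prod K.grp H.grp)))

/-- Composition in the associated category as a bilinear map. -/
noncomputable def circₗ (L K H : BisetCat k D) :
    A.obj (prod L K) →ₗ[k] A.obj (prod K H) →ₗ[k] A.obj (prod L H) :=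
  (A.mul (prod L K) (prod K H)).compr₂ (A.map (contractMor L K H))

noncomputable instance : Preadditive (AssocCat A) where
  homGroup := inferInstance
  add_comp _ _ _ α α' β := (circₗ _ _ _ β).map_add α α'
  comp_add _ _ _ α β β' := LinearMap.map_add₂ (circₗ _ _ _) β β' α

noncomputable instance : Linear k (AssocCat A) where
  homModule := inferInstance
  smul_comp _ _ _ r α β := (circₗ _ _ _ β).map_smul r α
  comp_smul _ _ _ α r β := LinearMap.map_smul₂ (circₗ _ _ _) r β α

variable (A)

/-! ### Modules -/

/-- The category of `A`-modules: `k`-linear functors from `P_A` to `k`-modules. -/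
abbrev Mod : Type _ :=
  ObjectProperty.FullSubcategory
    (fun M : AssocCat A ⥤ ModuleCat.{v} k => M.Additive ∧ M.Linear k)

/-- The action `α · a = A(K × ←H)(α × a)` of `α ∈ A(K × H)` on `a ∈ A(H)`. -/
noncomputable def actₗ (K H : BisetCat k D) :
    A.obj (prod K H) →ₗ[k] A.obj H →ₗ[k] A.obj K :=
  (A.mul (prod K H) H).compr₂ (A.map (contractRightMor K H))

variable {A} in
theorem actₗ_apply {K H : BisetCat k D} (α : A.obj (prod K H)) (a : A.obj H) :
    A.actₗ K H α a = A.map (contractRightMor K H) (A.mul (prod K H) H α a) := rfl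

variable {A} in
theorem actₗ_circ {L K H : BisetCat k D} (β : A.obj (prod L K)) (α : A.obj (prod K H))
    (a : A.obj H) : A.actₗ L H (circ β α) a = A.actₗ L K β (A.actₗ K H α a) := by
  simp only [actₗ_apply, circ]
  rw [mul_map_left, mul_map_right, A.map_map, A.map_map, A.mul_assoc, A.map_map]
  exact map_eq_map (contractRightMor_assoc L K H).symm _

variable {A} in
theorem actₗ_ident {H : BisetCat k D} (a : A.obj H) : A.actₗ H H (A.ident H) a = a := by
  simp only [actₗ_apply, ident]
  rw [mul_map_left, A.map_map, arrow_contractRightMor]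
  exact A.one_mul _ a

/-- The functor `A` as an `A`-module. -/
noncomputable def regular : A.Mod where
  obj :=
    { obj := fun H => A.obj H.grp
      map := fun {H K} α => ModuleCat.ofHom (A.actₗ K.grp H.grp α)
      map_id := fun _ => ModuleCat.hom_ext (LinearMap.ext fun a => actₗ_ident a)
      map_comp := fun α β => ModuleCat.hom_ext (LinearMap.ext fun a => actₗ_circ β α a) }
  property :=
    ⟨⟨fun {_ _ α β} => ModuleCat.hom_ext ((A.actₗ _ _).map_add α β)⟩,
      ⟨fun α r => ModuleCat.hom_ext ((A.actₗ _ _).map_smul r α)⟩⟩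

variable {A}

/-- The direct sum of two `A`-modules, defined pointwise. -/
noncomputable def Mod.directSum (M N : A.Mod) : A.Mod where
  obj :=
    { obj := fun H => ModuleCat.of k (M.obj.obj H × N.obj.obj H)
      map := fun α => ModuleCat.ofHom ((M.obj.map α).hom.prodMap (N.obj.map α).hom)
      map_id := fun _ => by
        ext x <;> simp
      map_comp := fun _ _ => by
        ext x <;> simp }
  property := by
    have := M.property.1
    have := M.property.2
    have := N.property.1
    have := N.property.2
    refine ⟨⟨fun {_ _ α β} => ?_⟩, ⟨fun α r => ?_⟩⟩
    · ext x <;> simp [Functor.map_add]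
    · ext x <;> simp [Functor.map_smul]

/-! ### Ideals -/

/-- A family of submodules `I(H) ≤ A(H)` is a two-sided ideal of `A` if it is a subfunctor that is
stable under the products with elements of `A` on both sides. -/
structure IsTwoSidedIdeal (I : ∀ H : BisetCat k D, Submodule k (A.obj H)) : Prop where
  map_mem : ∀ {H K : BisetCat k D} (α : H ⟶ K) {x : A.obj H}, x ∈ I H → A.map α x ∈ I K
  mul_mem_left : ∀ {K H : BisetCat k D} (a : A.obj K) {x : A.obj H}, x ∈ I H →
    A.mul K H a x ∈ I (prod K H)
  mul_mem_right : ∀ {K H : BisetCat k D} {x : A.obj K} (a : A.obj H), x ∈ I K →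
    A.mul K H x a ∈ I (prod K H)

variable {I : ∀ H : BisetCat k D, Submodule k (A.obj H)}

/-- A two-sided ideal as an `A`-module, by restricting the action of `A` on itself. -/
noncomputable def idealMod (hI : IsTwoSidedIdeal I) : A.Mod where
  obj :=
    { obj := fun H => ModuleCat.of k (I H.grp)
      map := fun {H K} α => ModuleCat.ofHom ((A.actₗ K.grp H.grp α).restrict
        (p := I H.grp) (q := I K.grp) fun _ hx => hI.map_mem _ (hI.mul_mem_left _ hx))
      map_id := fun H => ModuleCat.hom_ext (LinearMap.ext fun a =>
        Subtype.ext (actₗ_ident (a : A.obj H.grp)))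
      map_comp := fun {H _ _} α β => ModuleCat.hom_ext (LinearMap.ext fun a =>
        Subtype.ext (actₗ_circ β α (a : A.obj H.grp))) }
  property :=
    ⟨⟨fun {_ _ α β} => ModuleCat.hom_ext (LinearMap.ext fun x => Subtype.ext
        (DFunLike.congr_fun ((A.actₗ _ _).map_add α β) x.1))⟩,
      ⟨fun α r => ModuleCat.hom_ext (LinearMap.ext fun x => Subtype.ext
        (DFunLike.congr_fun ((A.actₗ _ _).map_smul r α) x.1))⟩⟩

/-- The left ideal `I(H × H)` of the endomorphism algebra of `H` in the associated category. -/
def idealEnd (hI : IsTwoSidedIdeal I) (H : AssocCat A) : Ideal (End H) where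
  carrier := {x | x ∈ I (prod H.grp H.grp)}
  add_mem' := (I (prod H.grp H.grp)).add_mem
  zero_mem' := (I (prod H.grp H.grp)).zero_mem
  smul_mem' _ _ hx := hI.map_mem _ (hI.mul_mem_left _ hx)

/-! ### Essential algebras -/

/-- The endomorphisms of `H` in `P_A` that factor through a group of order smaller than `|H|`. -/
def FactorsThroughSmaller {H : AssocCat A} (x : End H) : Prop :=
  ∃ (K : AssocCat A) (α : H ⟶ K) (β : K ⟶ H), Nat.card K.grp < Nat.card H.grp ∧ x = α ≫ β

/-- The ideal `I_A(H)` of the endomorphism algebra of `H`: the `k`-submodule generated by the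
endomorphisms that factor through groups of order smaller than `|H|`. -/
def essIdeal (H : AssocCat A) : Ideal (End H) where
  carrier := Submodule.span k {x : End H | FactorsThroughSmaller x}
  add_mem' := Submodule.add_mem _
  zero_mem' := Submodule.zero_mem _
  smul_mem' r x hx := by
    induction hx using Submodule.span_induction with
    | mem x hx =>
      obtain ⟨K, α, β, hK, rfl⟩ := hx
      refine Submodule.subset_span ⟨K, α, β ≫ r, hK, ?_⟩
      exact Category.assoc _ _ _
    | zero => rw [smul_zero]; exact Submodule.zero_mem _
    | add x y _ _ hx hy => rw [smul_add]; exact Submodule.add_mem _ hx hy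
    | smul c x _ hx => rw [smul_comm]; exact Submodule.smul_mem _ c hx

theorem mem_essIdeal {H : AssocCat A} {x : End H} :
    x ∈ essIdeal H ↔ x ∈ Submodule.span k {x : End H | FactorsThroughSmaller x} := Iff.rfl

instance (H : AssocCat A) : (essIdeal H).IsTwoSided where
  mul_mem_of_left {x} r hx := by
    rw [mem_essIdeal] at hx ⊢
    induction hx using Submodule.span_induction with
    | mem x hx =>
      obtain ⟨K, α, β, hK, rfl⟩ := hx
      refine Submodule.subset_span ⟨K, r ≫ α, β, hK, ?_⟩
      exact (Category.assoc _ _ _).symm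
    | zero => rw [zero_mul]; exact Submodule.zero_mem _
    | add x y _ _ hx hy => rw [add_mul]; exact Submodule.add_mem _ hx hy
    | smul c x _ hx => rw [smul_mul_assoc]; exact Submodule.smul_mem _ c hx

/-- The essential algebra of `A` at `H`. -/
abbrev EssAlg (H : AssocCat A) : Type v := End H ⧸ essIdeal H

/-- The image of `I(H × H)` in the essential algebra at `H`, for a two-sided ideal `I`. -/
def idealEss (hI : IsTwoSidedIdeal I) (H : AssocCat A) : Ideal (EssAlg H) where
  carrier := Ideal.Quotient.mk (essIdeal H) '' {x | x ∈ I (prod H.grp H.grp)}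
  add_mem' := by
    rintro _ _ ⟨x, hx, rfl⟩ ⟨y, hy, rfl⟩
    exact ⟨x + y, (idealEnd hI H).add_mem hx hy, map_add _ _ _⟩
  zero_mem' := ⟨0, (idealEnd hI H).zero_mem, map_zero _⟩
  smul_mem' := by
    rintro r _ ⟨x, hx, rfl⟩
    obtain ⟨r, rfl⟩ := Ideal.Quotient.mk_surjective r
    exact ⟨r * x, (idealEnd hI H).mul_mem_left r hx, _root_.map_mul _ _ _⟩

end GreenBisetFunctor

open GreenBisetFunctor

namespace GreenHom
variable {A C : GreenBisetFunctor.{u, v, w} k D} (f : GreenHom A C)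

theorem app_circ {L K H : BisetCat k D} (β : A.obj (prod L K)) (α : A.obj (prod K H)) :
    f.app _ (circ β α) = circ (f.app _ β) (f.app _ α) := by
  simp only [circ]
  rw [f.naturality, f.map_mul]

theorem app_ident (H : BisetCat k D) : f.app _ (A.ident H) = C.ident H := by
  simp only [ident]
  rw [f.naturality, f.map_one]

/-- The functor `P_f` between associated categories. -/
noncomputable def assocFunctor : AssocCat A ⥤ AssocCat C where
  obj H := ⟨H.grp⟩
  map {H K} α := f.app (prod K.grp H.grp) α
  map_id H := f.app_ident H.grp
  map_comp α β := f.app_circ β α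

instance : f.assocFunctor.Additive where
  map_add {_ _ α β} := (f.app _).map_add α β

instance : f.assocFunctor.Linear k where
  map_smul α r := (f.app _).map_smul r α

/-- The pullback functor `f^*` from `C`-modules to `A`-modules. -/
noncomputable def pullback : C.Mod ⥤ A.Mod :=
  ObjectProperty.lift _ (ObjectProperty.ι _ ⋙ (Functor.whiskeringLeft _ _ _).obj f.assocFunctor)
    (fun M => by
      have := M.property.1
      have := M.property.2
      exact ⟨inferInstanceAs (f.assocFunctor ⋙ M.obj).Additive,
        inferInstanceAs ((f.assocFunctor ⋙ M.obj).Linear k)⟩)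

/-- The homomorphism of endomorphism algebras induced by `f`. -/
noncomputable def endHom (H : AssocCat A) : End H →+* End (f.assocFunctor.obj H) where
  toFun := fun x => f.assocFunctor.map x
  map_one' := f.assocFunctor.map_id H
  map_mul' x y := f.assocFunctor.map_comp y x
  map_zero' := f.assocFunctor.map_zero H H
  map_add' _ _ := f.assocFunctor.map_add

theorem essIdeal_le (H : AssocCat A) :
    essIdeal H ≤ (essIdeal (f.assocFunctor.obj H)).comap (f.endHom H) := by
  intro x hx
  rw [mem_essIdeal] at hx
  rw [Ideal.mem_comap, mem_essIdeal]
  induction hx using Submodule.span_induction with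
  | mem x hx =>
    obtain ⟨K, α, β, hK, rfl⟩ := hx
    exact Submodule.subset_span ⟨f.assocFunctor.obj K, f.assocFunctor.map α, f.assocFunctor.map β,
      hK, f.assocFunctor.map_comp α β⟩
  | zero => rw [map_zero]; exact Submodule.zero_mem _
  | add x y _ _ hx hy => rw [map_add]; exact Submodule.add_mem _ hx hy
  | smul c x _ hx =>
    have : f.endHom H (c • x) = c • f.endHom H x := f.assocFunctor.map_smul c x
    rw [this]; exact Submodule.smul_mem _ c hx

/-- The homomorphism of essential algebras induced by `f`. -/
noncomputable def essHom (H : AssocCat A) : EssAlg H →+* EssAlg (f.assocFunctor.obj H) :=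
  Ideal.quotientMap _ (f.endHom H) (f.essIdeal_le H)

/-- A module over the endomorphism algebra of `H` in `P_C`, seen as a module over the endomorphism
algebra of `H` in `P_A` through `f`. -/
noncomputable abbrev endRestrict (H : AssocCat A) (M : Type v) [AddCommGroup M]
    [Module (End (f.assocFunctor.obj H)) M] : ModuleCat.{v} (End H) :=
  (ModuleCat.restrictScalars (f.endHom H)).obj (ModuleCat.of (End (f.assocFunctor.obj H)) M)

/-- A module over the essential algebra of `C` at `H`, seen as a module over the essential algebra
of `A` at `H` through `f`. -/
noncomputable abbrev essRestrict (H : AssocCat A) (M : Type v) [AddCommGroup M]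
    [Module (EssAlg (f.assocFunctor.obj H)) M] : ModuleCat.{v} (EssAlg H) :=
  (ModuleCat.restrictScalars (f.essHom H)).obj (ModuleCat.of (EssAlg (f.assocFunctor.obj H)) M)

/-- The kernel of a morphism of Green biset functors. -/
def ker (H : BisetCat k D) : Submodule k (A.obj H) := LinearMap.ker (f.app H)

theorem isTwoSidedIdeal_ker : IsTwoSidedIdeal f.ker where
  map_mem α x hx := by
    rw [ker, LinearMap.mem_ker] at hx ⊢
    rw [f.naturality, hx, map_zero]
  mul_mem_left a x hx := by
    rw [ker, LinearMap.mem_ker] at hx ⊢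
    rw [f.map_mul, hx, map_zero]
  mul_mem_right a hx := by
    rw [ker, LinearMap.mem_ker] at hx ⊢
    rw [f.map_mul, hx, LinearMap.map_zero₂]

end GreenHom

/-! ### Shifted Green biset functors, inflation and restriction -/

namespace GreenBisetFunctor
variable (A : GreenBisetFunctor.{u, v, w} k D) (G : BisetCat k D)

variable {A} in
theorem shift_mul_assoc {L K H : BisetCat k D} (a : A.obj (prod L G)) (b : A.obj (prod K G))
    (c : A.obj (prod H G)) :
    A.map (diagMor G (prod L K) H) (A.mul _ _ (A.map (diagMor G L K) (A.mul _ _ a b)) c) =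
      A.map (extProd (isoAssoc k L K H) (𝟙 G)) (A.map (diagMor G L (prod K H))
        (A.mul _ _ a (A.map (diagMor G K H) (A.mul _ _ b c)))) := by
  rw [mul_map_left, mul_map_right, A.mul_assoc, A.map_map, A.map_map, A.map_map, A.map_map]
  exact map_eq_map (shift_assoc G L K H) _

variable {A} in
theorem shift_one_mul {H : BisetCat k D} (a : A.obj (prod H G)) :
    A.map (extProd (isoLambda H) (𝟙 G)) (A.map (diagMor G (one k D) H)
      (A.mul _ _ (A.map (infMor G (one k D)) A.ε) a)) = a := by
  rw [mul_map_left, A.map_map, A.map_map]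
  exact Eq.trans (map_eq_map (shift_one_left G H) _) (A.one_mul _ a)

variable {A} in
theorem shift_mul_one {H : BisetCat k D} (a : A.obj (prod H G)) :
    A.map (extProd (isoRho H) (𝟙 G)) (A.map (diagMor G H (one k D))
      (A.mul _ _ a (A.map (infMor G (one k D)) A.ε))) = a := by
  rw [mul_map_right, A.map_map, A.map_map]
  exact Eq.trans (map_eq_map (shift_one_right G H) _) (A.mul_one _ a)

variable {A} in
theorem shift_map_mul {K T H L : BisetCat k D} (α : K ⟶ T) (β : H ⟶ L) (a : A.obj (prod K G))
    (b : A.obj (prod H G)) :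
    A.map (extProd (extProd α β) (𝟙 G)) (A.map (diagMor G K H) (A.mul _ _ a b)) =
      A.map (diagMor G T L)
        (A.mul _ _ (A.map (extProd α (𝟙 G)) a) (A.map (extProd β (𝟙 G)) b)) := by
  rw [← A.map_mul, A.map_map, A.map_map, diagMor_natural]

/-- The Green biset functor `A_G`, with products `a ×ᵈ b` induced by the restriction of `a × b`
along the homomorphism `(K × H) × G → (K × G) × (H × G)` that is diagonal on `G`. -/
noncomputable def shift : GreenBisetFunctor.{u, v, w} k D where
  toBisetFunctor := A.toBisetFunctor.shift G
  mul K H := (A.mul (prod K G) (prod H G)).compr₂ (A.map (diagMor G K H))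
  ε := A.map (infMor G (one k D)) A.ε
  mul_assoc _ _ _ a b c := shift_mul_assoc G a b c
  one_mul _ a := shift_one_mul G a
  mul_one _ a := shift_mul_one G a
  map_mul α β a b := shift_map_mul G α β a b

variable {A} in
theorem res_map_mul {K H : BisetCat k D} (a : A.obj (prod K G)) (b : A.obj (prod H G)) :
    A.map (resMor G (prod K H)) (A.map (diagMor G K H) (A.mul _ _ a b)) =
      A.mul K H (A.map (resMor G K) a) (A.map (resMor G H) b) := by
  rw [← A.map_mul, A.map_map, resMor_prod]

variable {A} in
theorem res_naturality {H K : BisetCat k D} (α : H ⟶ K) (a : A.obj (prod H G)) :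
    A.map (resMor G K) (A.map (extProd α (𝟙 G)) a) = A.map α (A.map (resMor G H) a) := by
  rw [A.map_map, A.map_map, resMor_natural]

variable {A} in
theorem res_inf {H : BisetCat k D} (a : A.obj H) :
    A.map (resMor G H) (A.map (infMor G H) a) = a := by
  rw [A.map_map, infMor_resMor, A.map_id]

variable {A} in
theorem inf_map_mul {K H : BisetCat k D} (a : A.obj K) (b : A.obj H) :
    A.map (infMor G (prod K H)) (A.mul K H a b) = A.map (diagMor G K H)
      (A.mul _ _ (A.map (infMor G K) a) (A.map (infMor G H) b)) := by
  rw [← A.map_mul, A.map_map, infMor_prod]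

variable {A} in
theorem inf_naturality {H K : BisetCat k D} (α : H ⟶ K) (a : A.obj H) :
    A.map (infMor G K) (A.map α a) = A.map (extProd α (𝟙 G)) (A.map (infMor G H) a) := by
  rw [A.map_map, A.map_map, infMor_natural]

/-- The inflation morphism `Inf : A → A_G`. -/
noncomputable def inf : GreenHom A (A.shift G) where
  app H := A.map (infMor G H)
  naturality α a := inf_naturality G α a
  map_mul _ _ a b := inf_map_mul G a b
  map_one := rfl

/-- The restriction morphism `Res : A_G → A`. -/
noncomputable def res : GreenHom (A.shift G) A where
  app H := A.map (resMor G H)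
  naturality α a := res_naturality G α a
  map_mul _ _ a b := res_map_mul G a b
  map_one := res_inf G A.ε

/-- The kernel `κ_G` of the restriction morphism. -/
noncomputable abbrev kappa (H : BisetCat k D) : Submodule k ((A.shift G).obj H) :=
  (A.res G).ker H

end GreenBisetFunctor
end

end GreenBiset

namespace GreenBiset

open CategoryTheory BisetCat GreenBisetFunctor

namespace GreenHom

variable {k : Type w} [CommRing k] {D : ObjectProperty FiniteGrp.{u}} [Admissible D]
  {A C : GreenBisetFunctor.{u, v, w} k D}

/-! The morphism `Res` is a left inverse of `Inf`: inflation is restriction along the projection `H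
× G → H`, and the inclusion `h ↦ (h, 1)` followed by this projection is the identity of `H`.
Everything else is formal and holds for any morphism `f : A → C` of Green biset functors with a
retraction `r : C → A`, that is, with `r ∘ f = id`; the proof is carried out at that level.

For such a pair, every `x` in `C(H)` decomposes as `f(r(x)) + (x - f(r(x)))`. The first summand is
determined by `r(x)` and the second lies in the kernel of `r`, so `x ↦ (r(x), x - f(r(x)))`
identifies `C(H)` with `A(H) ⊕ ker(r)(H)`; this is `splitting`. Kernels of morphisms are two-sided
ideals, so the second factor is a module in its own right.

The splitting is `A`-linear because an element `α` of `A` acts on `C` through `f(α)`. Morphisms of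
Green biset functors preserve both the action (`app_actₗ`) and the composition of associated
categories (`GreenHom.app_circ`), hence `r(f(α) · x) = r(f(α)) · r(x) = α · r(x)`. Applying `f`
gives `f(α) · f(r(x))`, and subtraction shows that the second component is linear as well. With the
action on `C(H)` this gives the isomorphism of `A`-modules; with composition on `C(H × H)` it gives
the splitting of endomorphism algebras.

For the essential algebras, the functors between associated categories keep the underlying groups.
They therefore send a factorization through a smaller group to another such factorization, and both
`f` and `r` descend to ring homomorphisms `f.essHom` and `r.essHom`, again with composite the
identity. The delicate point is that the kernel of `r.essHom` must be the image of `ker(r)(H × H)`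
and nothing larger. If `r(x)` is in the essential ideal of `A`, then `f(r(x))` is in that of `C`, so
`x` has the same class as `x - f(r(x))`, which lies in the kernel of `r`. The lemmas
`sub_mem_idealEss` and `essHom_eq_zero` supply the two inclusions. -/

/-- A morphism of Green biset functors is compatible with the actions of `A` and `C` on
themselves. -/
theorem app_actₗ (f : GreenHom A C) {K H : BisetCat k D} (α : A.obj (prod K H)) (a : A.obj H) :
    f.app K (A.actₗ K H α a) = C.actₗ K H (f.app _ α) (f.app H a) := by
  rw [actₗ_apply, f.naturality, f.map_mul, actₗ_apply]

/-! ### Split morphisms of Green biset functors -/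

/-- `r` is a retraction of `f` if `r ∘ f` is the identity. -/
def IsRetraction (f : GreenHom A C) (r : GreenHom C A) : Prop :=
  ∀ (H : BisetCat k D) (a : A.obj H), r.app H (f.app H a) = a

namespace IsRetraction

variable {f : GreenHom A C} {r : GreenHom C A} (hr : f.IsRetraction r)

include hr

/-- Since `r ∘ f = id`, the endomorphism `f ∘ r` of `C(H)` is idempotent; its complement `id - f ∘
r` is the projection onto the kernel of `r`. -/
theorem sub_mem_ker {H : BisetCat k D} (x : C.obj H) : x - f.app H (r.app H x) ∈ r.ker H := by
  rw [ker, LinearMap.mem_ker, map_sub, hr, sub_self]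

/-- A retraction splits the value of `C` at `H` into the value of `A` and the kernel. -/
noncomputable def splitting (H : BisetCat k D) : C.obj H ≃ₗ[k] A.obj H × r.ker H where
  toFun x := (r.app H x, ⟨x - f.app H (r.app H x), hr.sub_mem_ker x⟩)
  map_add' x y := Prod.ext (map_add _ _ _) (Subtype.ext (by
    simp only [map_add, Prod.snd_add, Submodule.coe_add]
    abel))
  map_smul' c x := Prod.ext (map_smul _ _ _) (Subtype.ext (by
    simp only [map_smul, Prod.smul_snd, Submodule.coe_smul, smul_sub, RingHom.id_apply]))
  invFun p := f.app H p.1 + p.2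
  -- This direction is a cancellation valid for arbitrary maps; the retraction equation is needed
  -- for the other one.
  left_inv x := add_sub_cancel _ _
  right_inv := by
    rintro ⟨a, y, hy⟩
    have hy' : r.app H y = 0 := hy
    -- Both components come from `r(f(a) + y) = a`; after that, subtracting `f(a)` leaves `y`.
    refine Prod.ext ?_ (Subtype.ext ?_)
    · simp only [map_add, hr H a, hy', add_zero]
    · simp only [map_add, hr H a, hy', add_zero, add_sub_cancel_left]

/-! ### Linearity of the splitting: modules and endomorphism algebras -/

/-- The pullback of the regular `C`-module along a split morphism `f` is the direct sum of the
regular `A`-module and the kernel of a retraction of `f`. -/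
noncomputable def regularIso : f.pullback.obj C.regular ≅
    A.regular.directSum (f.pullback.obj (idealMod r.isTwoSidedIdeal_ker)) :=
  ObjectProperty.isoMk _ (NatIso.ofComponents (fun H => (hr.splitting H.grp).toModuleIso)
    (fun {H K} α => ModuleCat.hom_ext (LinearMap.ext fun (x : C.obj H.grp) => by
      -- On the pullback, `α` acts as `f(α)`. Applying `r` turns this action into that of `r(f(α)) =
      -- α`, which is naturality of the first component.
      have h1 : r.app K.grp (C.actₗ K.grp H.grp (f.app _ α) x) =
          A.actₗ K.grp H.grp α (r.app H.grp x) :=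
        (r.app_actₗ _ _).trans (congrArg (A.actₗ K.grp H.grp · _) (hr _ α))
      refine Prod.ext h1 (Subtype.ext ?_)
      -- In the second component, `h1` replaces the subtracted term by `f(α · r(x))`, which is `f(α)
      -- · f(r(x))`; the factor `f(α)` then comes out by linearity of its action.
      refine (congrArg (fun t => C.actₗ K.grp H.grp (f.app _ α) x - f.app K.grp t) h1).trans ?_
      exact (congrArg (C.actₗ K.grp H.grp (f.app _ α) x - ·) (f.app_actₗ _ _)).trans
        (map_sub (C.actₗ K.grp H.grp (f.app _ α)) _ _).symm)))

/-- The splitting of the endomorphism algebra of `H` in `P_C`. -/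
noncomputable def endEquiv (H : AssocCat A) :
    f.endRestrict H (End (f.assocFunctor.obj H)) ≃ₗ[End H]
      End H × f.endRestrict H (idealEnd r.isTwoSidedIdeal_ker (f.assocFunctor.obj H)) where
  -- The endomorphisms of `H` in the associated category of `C` are the elements of `C(H × H)`, so
  -- the bijection is the splitting at `H × H` and only left linearity remains.
  __ := (hr.splitting (prod H.grp H.grp)).toAddEquiv
  map_smul' (a : A.obj (prod H.grp H.grp)) (x : C.obj (prod H.grp H.grp)) := by
    -- A product `a * x` in an endomorphism ring is `x` followed by `a`, that is `circ a x`, so a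
    -- scalar `a` acts by `circ (f(a))`. The argument is that of the module case with `circ` in
    -- place of the action.
    have h1 : r.app (prod H.grp H.grp) (circ (f.app (prod H.grp H.grp) a) x) =
        circ a (r.app (prod H.grp H.grp) x) :=
      (r.app_circ _ _).trans (congrArg (circ · _) (hr _ a))
    refine Prod.ext h1 (Subtype.ext ?_)
    refine (congrArg (fun t => circ (f.app (prod H.grp H.grp) a) x - f.app _ t) h1).trans ?_
    exact (congrArg (circ (f.app (prod H.grp H.grp) a) x - ·) (f.app_circ _ _)).trans
      (map_sub (circₗ H.grp H.grp H.grp (f.app (prod H.grp H.grp) a)) _ _).symm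

/-! ### Splitting of the essential algebras -/

/-- The retraction survives on the quotients because both induced maps are computed on
representatives. The equation is well typed because applying both functors returns an object with
the same group, which is definitionally `H`. -/
theorem essHom_essHom {H : AssocCat A} (a : EssAlg H) :
    r.essHom (f.assocFunctor.obj H) (f.essHom H a) = a := by
  obtain ⟨a, rfl⟩ := Ideal.Quotient.mk_surjective a
  exact congrArg (Ideal.Quotient.mk (essIdeal H)) (hr _ a)

/-- Gives one half of the equality between the kernel of `r.essHom` and the image of the kernel of
`r`: if `r.essHom` kills `x`, the difference is `x` itself. No correction of the representative is
required, since the difference can be formed before passing to the quotient. -/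
theorem sub_mem_idealEss {H : AssocCat A} (x : EssAlg (f.assocFunctor.obj H)) :
    x - f.essHom H (r.essHom (f.assocFunctor.obj H) x) ∈
      idealEss r.isTwoSidedIdeal_ker (f.assocFunctor.obj H) := by
  obtain ⟨x, rfl⟩ := Ideal.Quotient.mk_surjective x
  exact ⟨_, hr.sub_mem_ker x, rfl⟩

-- The other half: a class represented by an element of the kernel of `r` is killed. This holds for
-- any morphism, with or without a section.
omit hr in
theorem essHom_eq_zero {H : AssocCat C} {x : EssAlg H}
    (hx : x ∈ idealEss r.isTwoSidedIdeal_ker H) : r.essHom H x = 0 := by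
  obtain ⟨x, hx, rfl⟩ := hx
  exact (congrArg (Ideal.Quotient.mk (essIdeal (r.assocFunctor.obj H))) hx).trans (map_zero _)

/-- The splitting of the essential algebra of `C` at `H`. -/
noncomputable def essEquiv (H : AssocCat A) :
    f.essRestrict H (EssAlg (f.assocFunctor.obj H)) ≃ₗ[EssAlg H]
      EssAlg H × f.essRestrict H (idealEss r.isTwoSidedIdeal_ker (f.assocFunctor.obj H)) where
  -- The formula of `splitting` is repeated on classes, so that the compatibility with the splitting
  -- of the endomorphism algebra holds by computation.
  toFun (x : EssAlg (f.assocFunctor.obj H)) := (r.essHom (f.assocFunctor.obj H) x,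
    (⟨x - f.essHom H (r.essHom (f.assocFunctor.obj H) x), hr.sub_mem_idealEss x⟩ :
      idealEss r.isTwoSidedIdeal_ker (f.assocFunctor.obj H)))
  map_add' (x y : EssAlg (f.assocFunctor.obj H)) := by
    have h1 := map_add (r.essHom (f.assocFunctor.obj H)) x y
    refine Prod.ext h1 (Subtype.ext ?_)
    have h2 := (congrArg (f.essHom H) h1).trans (map_add (f.essHom H) _ _)
    exact (congrArg (x + y - ·) h2).trans (add_sub_add_comm _ _ _ _)
  map_smul' (a : EssAlg H) (x : EssAlg (f.assocFunctor.obj H)) := by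
    -- The `show` views a value of `r.essHom`, whose type mentions the twice transported object, as
    -- an element of the essential algebra at `H` itself, where it can be multiplied by `a`.
    have h1 : r.essHom (f.assocFunctor.obj H) (f.essHom H a * x) =
        a * (show EssAlg H from r.essHom (f.assocFunctor.obj H) x) :=
      (_root_.map_mul (r.essHom (f.assocFunctor.obj H)) _ _).trans
        (congrArg (· * _) (hr.essHom_essHom a))
    refine Prod.ext h1 (Subtype.ext ?_)
    have h2 := (congrArg (f.essHom H) h1).trans (_root_.map_mul (f.essHom H) _ _)
    exact (congrArg (f.essHom H a * x - ·) h2).trans (mul_sub _ _ _).symm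
  invFun p := f.essHom H p.1 +
    (p.2 : idealEss r.isTwoSidedIdeal_ker (f.assocFunctor.obj H)).1
  left_inv (x : EssAlg (f.assocFunctor.obj H)) := add_sub_cancel _ x
  right_inv := by
    rintro ⟨a, (y : idealEss r.isTwoSidedIdeal_ker (f.assocFunctor.obj H))⟩
    -- Here the image of the kernel must vanish under `r.essHom`; this makes the sum direct.
    have h1 : r.essHom (f.assocFunctor.obj H) (f.essHom H a + y.1) = a := by
      refine (map_add (r.essHom (f.assocFunctor.obj H)) _ _).trans ?_
      exact (congrArg₂ (· + ·) (hr.essHom_essHom a) (essHom_eq_zero y.2)).trans (add_zero a)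
    refine Prod.ext h1 (Subtype.ext ?_)
    exact (congrArg (fun t => f.essHom H a + y.1 - f.essHom H t) h1).trans
      (add_sub_cancel_left _ _)

end IsRetraction

end GreenHom

/-! ### Application to inflation and restriction -/

theorem GreenBisetFunctor.isRetraction_res {k : Type w} [CommRing k]
    {D : ObjectProperty FiniteGrp.{u}} [Admissible D] (A : GreenBisetFunctor.{u, v, w} k D)
    (G : BisetCat k D) : (A.inf G).IsRetraction (A.res G) := fun _ a => res_inf G a

end GreenBiset

/-- The last two equations express that `e'` is induced by `e`. As the quotient map is surjective,
they determine `e'`; the second one is stated in the ambient essential algebra. -/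
theorem mainTheorem2 {k : Type w} [CommRing k] {D : CategoryTheory.ObjectProperty FiniteGrp.{u}}
    [GreenBiset.Admissible D] (A : GreenBiset.GreenBisetFunctor.{u, v, w} k D)
    (G : GreenBiset.BisetCat k D) :
    ∃ hκ : GreenBiset.GreenBisetFunctor.IsTwoSidedIdeal (A.kappa G),
      Nonempty ((A.inf G).pullback.obj (A.shift G).regular ≅
        A.regular.directSum ((A.inf G).pullback.obj
          (GreenBiset.GreenBisetFunctor.idealMod hκ))) ∧
      ∀ H : GreenBiset.GreenBisetFunctor.AssocCat A,
        -- `H` as an object of the associated category of `A_G`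
        let H' : GreenBiset.GreenBisetFunctor.AssocCat (A.shift G) :=
          (A.inf G).assocFunctor.obj H
        ∃ (e : (A.inf G).endRestrict H (CategoryTheory.End H') ≃ₗ[CategoryTheory.End H]
            CategoryTheory.End H ×
              (A.inf G).endRestrict H (GreenBiset.GreenBisetFunctor.idealEnd hκ H'))
          (e' : (A.inf G).essRestrict H (GreenBiset.GreenBisetFunctor.EssAlg H')
              ≃ₗ[GreenBiset.GreenBisetFunctor.EssAlg H]
            GreenBiset.GreenBisetFunctor.EssAlg H ×
              (A.inf G).essRestrict H (GreenBiset.GreenBisetFunctor.idealEss hκ H')),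
          ∀ x : CategoryTheory.End H',
            (e' (Ideal.Quotient.mk (GreenBiset.GreenBisetFunctor.essIdeal H') x)).1 =
              Ideal.Quotient.mk (GreenBiset.GreenBisetFunctor.essIdeal H) (e x).1 ∧
            (e' (Ideal.Quotient.mk (GreenBiset.GreenBisetFunctor.essIdeal H') x)).2.1 =
              Ideal.Quotient.mk (GreenBiset.GreenBisetFunctor.essIdeal H') (e x).2.1 := by
  have hr := A.isRetraction_res G
  exact ⟨(A.res G).isTwoSidedIdeal_ker, ⟨hr.regularIso⟩,
    -- Both equivalences are `x ↦ (r(x), x - f(r(x)))`, and the maps on quotients evaluate on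
    -- representatives, so each square commutes definitionally.
    fun H => ⟨hr.endEquiv H, hr.essEquiv H, fun _ => ⟨rfl, rfl⟩⟩⟩
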